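/- Let $E$ be a finite-dimensional real normed space (for instance $\mathbb R^d$ with the Euclidean norm) and let $P,Q$ be arbitrary Borel probability measures on $E$. For a classifier $f:E\to\{0,1\}$ (value $1$ meaning "predicted to come from $P$") put $$\mathrm{fpr}(f)=\int (1-f)\,dP,\qquad \mathrm{fnr}(f)=\int f\,dQ ,$$ and, for $\lambda\in[0,\infty]$, let $\alpha_\lambda(P,Q)=(\lambda P\wedge Q)(E)$, where $\wedge$ is the minimum of measures. Throughout $\infty\cdot 0=0$. Let $\mathcal X=(x_1,\dots,x_n)$ and $\mathcal Y=(y_1,\dots,y_n)$ be independent i.i.d. samples from $P$ and $Q$. For $1\le k\le 2n$ and $z\in E$ let $B_k(z)$ be the closed ball around $z$ whose radius is the $k$-th smallest distance from $z$ to the $2n$ points of $\mathcal X\cup\mathcal Y$ (counted with multiplicity). For $\gamma\in[0,\infty]$ the kNN classifier is $$f_\gamma^{kNN}(z)=\mathbf 1\bigl\{\gamma\,\#\{i:x_i\in B_k(z)\}\ge \#\{i:y_i\in B_k(z)\}\bigr\}\quad(\gamma\ge 1),$$ and the same with strict inequality $>$ for $\gamma<1$. All limits below are in the joint regime $k\to\infty$,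 $n\to\infty$, $k/n\to0$. **1.** For every $\lambda\in[0,\infty]$ the parameter $\gamma=\lambda$ minimizes the limiting expected risk: the limit $$L_\lambda=\lim \mathbb E\bigl[\lambda\,\mathrm{fpr}(f_\lambda^{kNN})+\mathrm{fnr}(f_\lambda^{kNN})\bigr]\in[0,\infty]$$ exists and, for every $\gamma\in[0,\infty]$, $$L_\lambda\le\liminf\ \mathbb E\bigl[\lambda\,\mathrm{fpr}(f_\gamma^{kNN})+\mathrm{fnr}(f_\gamma^{kNN})\bigr].$$ **2.** (Universal consistency with data split.) Let the classifiers $f_\gamma^{kNN}$ be fitted on training samples with $n$ points per class as above, let $x'_1,\dots,x'_m\sim P$ and $y'_1,\dots,y'_m\sim Q$ be independent validation samples, independent of the training samples, and put $$\hat\alpha_\lambda^{kNN}=\min_f\Bigl\{\lambda\,\frac1m\sum_{i=1}^m\bigl(1-f(x'_i)\bigr)+\frac1m\sum_{i=1}^m f(y'_i)\Bigr\},$$ the minimum being over all $f_\gamma^{kNN}$, $\gamma\in[0,\infty]$, and the two constant classifiers $f\equiv0$ and $f\equiv1$. Then for every $\lambda\in[0,\infty)$ $$\mathbb E[\hat\alpha_\lambda^{kNN}]\to\alpha_\lambda(P,Q)$$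 as $k\to\infty$, $n\to\infty$, $k/n\to0$ and $m\to\infty$. -/

import Mathlib

open MeasureTheory Filter Topology
open scoped ENNReal

namespace KnnPR

noncomputable section

/-- The `k`-nearest-neighbour ball around `z` computed within the finite family `S`: the closed
ball centred at `z` whose radius is the `k`-th smallest of the distances `dist (S j) z`, counted
with multiplicity (a point `w` lies in that ball iff fewer than `k` points of `S` are strictly
closer to `z` than `w`). All points at distance exactly the radius belong to it. -/
def knnBall {E : Type*} [PseudoMetricSpace E] {ι : Type*} [Fintype ι]
    (k : ℕ) (S : ι → E) (z : E) : Set E :=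
  {w | (Finset.univ.filter fun j => dist (S j) z < dist w z).card < k}

/-- A sample: `n` points drawn from `P` (first component) and `n` from `Q` (second component). -/
abbrev Sample (E : Type*) (n : ℕ) : Type _ := (Fin n → E) × (Fin n → E)

/-- The pooled family made of both parts of a sample. -/
def pooled {E : Type*} {n : ℕ} (s : Sample E n) : Fin n ⊕ Fin n → E := Sum.elim s.1 s.2

open Classical in
/-- Number of points of the family `A` that lie in the set `B`, with multiplicity. -/
def count {E : Type*} {n : ℕ} (A : Fin n → E) (B : Set E) : ℕ :=
  (Finset.univ.filter fun i => A i ∈ B).card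

open Classical in
/-- The kNN classifier with parameter `γ ∈ [0, ∞]` fitted on the sample `s`; the value `1` means
"predicted to come from `P`". With `a`, `b` the numbers of points of the first and second part of
`s` in the kNN ball of the pooled sample, it is the indicator of `γ * a ≥ b` when `1 ≤ γ` and of
`γ * a > b` when `γ < 1` (with `∞ * 0 = 0`). -/
def knnClassifier {E : Type*} [PseudoMetricSpace E] {n : ℕ}
    (k : ℕ) (γ : ℝ≥0∞) (s : Sample E n) (z : E) : ℝ≥0∞ :=
  let a : ℝ≥0∞ := (count s.1 (knnBall k (pooled s) z) : ℝ≥0∞)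
  let b : ℝ≥0∞ := (count s.2 (knnBall k (pooled s) z) : ℝ≥0∞)
  if (1 ≤ γ ∧ b ≤ γ * a) ∨ (γ < 1 ∧ b < γ * a) then 1 else 0

/-- False positive rate `∫ (1 - f) dP` of a `{0, 1}`-valued classifier. -/
def fpr {E : Type*} [MeasurableSpace E] (P : Measure E) (f : E → ℝ≥0∞) : ℝ≥0∞ :=
  ∫⁻ z, (1 - f z) ∂P

/-- False negative rate `∫ f dQ` of a `{0, 1}`-valued classifier. -/
def fnr {E : Type*} [MeasurableSpace E] (Q : Measure E) (f : E → ℝ≥0∞) : ℝ≥0∞ :=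
  ∫⁻ z, f z ∂Q

/-- Weighted risk `lam * fpr f + fnr f` (with `∞ * 0 = 0`). -/
def risk {E : Type*} [MeasurableSpace E] (P Q : Measure E) (lam : ℝ≥0∞) (f : E → ℝ≥0∞) : ℝ≥0∞ :=
  lam * fpr P f + fnr Q f

/-- The precision `α_lam(P, Q)`: the total mass of the minimum of the measures `lam P` and `Q`. -/
def alpha {E : Type*} [MeasurableSpace E] (P Q : Measure E) (lam : ℝ≥0∞) : ℝ≥0∞ :=
  (lam • P ⊓ Q) Set.univ

/-- Law of a sample: `n` i.i.d. points from `P` and, independently, `n` i.i.d. points from `Q`. -/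
def sampleLaw {E : Type*} [MeasurableSpace E] (P Q : Measure E) (n : ℕ) : Measure (Sample E n) :=
  (Measure.pi fun _ : Fin n => P).prod (Measure.pi fun _ : Fin n => Q)

/-- Expected weighted risk, over the training sample, of the kNN classifier with parameter `γ`. -/
def expectedRisk {E : Type*} [PseudoMetricSpace E] [MeasurableSpace E] (P Q : Measure E)
    (lam γ : ℝ≥0∞) (k n : ℕ) : ℝ≥0∞ :=
  ∫⁻ s, risk P Q lam (knnClassifier k γ s) ∂(sampleLaw P Q n)

/-- Empirical false positive rate on the first part of the evaluation sample. -/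
def empFpr {E : Type*} {m : ℕ} (v : Sample E m) (f : E → ℝ≥0∞) : ℝ≥0∞ :=
  (∑ i, (1 - f (v.1 i))) / (m : ℝ≥0∞)

/-- Empirical false negative rate on the second part of the evaluation sample. -/
def empFnr {E : Type*} {m : ℕ} (v : Sample E m) (f : E → ℝ≥0∞) : ℝ≥0∞ :=
  (∑ i, f (v.2 i)) / (m : ℝ≥0∞)

/-- Empirical weighted risk on the evaluation sample. -/
def empRisk {E : Type*} {m : ℕ} (v : Sample E m) (lam : ℝ≥0∞) (f : E → ℝ≥0∞) : ℝ≥0∞ :=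
  lam * empFpr v f + empFnr v f

/-- The kNN estimate of `α_lam` with data split: classifiers are fitted on the training sample `s`,
and the empirical risk on the validation sample `v` is minimized over all `γ ∈ [0, ∞]` and over
the two constant classifiers. -/
def alphaHat {E : Type*} [PseudoMetricSpace E] {n m : ℕ}
    (lam : ℝ≥0∞) (k : ℕ) (s : Sample E n) (v : Sample E m) : ℝ≥0∞ :=
  (⨅ γ : ℝ≥0∞, empRisk v lam (knnClassifier k γ s)) ⊓
    (empRisk v lam (fun _ => 1) ⊓ empRisk v lam (fun _ => 0))

/-- Expectation of the kNN estimate over independent training and validation samples, with `n` and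
`m` points per class respectively. -/
def expectedAlphaHat {E : Type*} [PseudoMetricSpace E] [MeasurableSpace E] (P Q : Measure E)
    (lam : ℝ≥0∞) (k n m : ℕ) : ℝ≥0∞ :=
  ∫⁻ w, alphaHat lam k w.1 w.2 ∂((sampleLaw P Q n).prod (sampleLaw P Q m))

/-- The regime `k → ∞`, `n → ∞`, `k / n → 0` for pairs `(k, n)`. -/
def regime : Filter (ℕ × ℕ) :=
  comap Prod.fst atTop ⊓ comap Prod.snd atTop ⊓
    comap (fun p : ℕ × ℕ => (p.1 : ℝ) / (p.2 : ℝ)) (𝓝 0)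

/-- The minimizers `γ ∈ [0, ∞]` of the limiting expected risk: the limit exists at `γ`, and no
other parameter does better even in the lower limit (for the other parameters the limit itself
need not exist; where it exists, it equals the lower limit). -/
def optimalParams {E : Type*} [PseudoMetricSpace E] [MeasurableSpace E] (P Q : Measure E)
    (lam : ℝ≥0∞) : Set ℝ≥0∞ :=
  {γ | ∃ L : ℝ≥0∞,
    Tendsto (fun p : ℕ × ℕ => expectedRisk P Q lam γ p.1 p.2) regime (𝓝 L) ∧
    ∀ γ' : ℝ≥0∞, L ≤ liminf (fun p : ℕ × ℕ => expectedRisk P Q lam γ' p.1 p.2) regime}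

end

end KnnPR

/-! Let `p`, `q` be the densities of `P`, `Q` with respect to `P + Q`. For finite `lam` the limiting
risk is `alpha`, the integral of `min (lam * p) q`. No classifier has risk below it
(`alpha_le_risk`), so it suffices that the kNN vote with `γ = lam` copies the Bayes rule.
Besicovitch differentiation shows that at almost every `z` the masses of small balls are in
proportion `p z : q z`. Hence, if `u * p z + v * q z > 0`, the same combination of ball masses is
positive with a margin, and Chebyshev passes this to the vote counts (`tendsto_prob_linear_votes`).
Taking `(u, v) = ±(lam, -1)` settles every `z` with `lam * p z ≠ q z`; at a tie both decisions cost
the same. Dominated convergence concludes (`tendsto_expectedRisk`). Spheres may carry mass, so the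
kNN ball can jump past a prescribed mass. A radius is fixed at a quantile, and the closed and the
open ball of that radius are both controlled (`linear_count_knnBall_pos`).

For `lam = ∞` any positive expected false positive rate costs `∞`. Either for a non-null set of `z`
some ball around `z` is charged by `Q` while `P` charges its complement, and then every parameter
has infinite expected risk; or `γ = ∞` makes almost surely no false positive, and the limit is `Q
P.support`, again a lower bound for every parameter.

With a data split, the upper bound compares the minimum with the single classifier `γ = lam`. The
lower bound needs a uniform deviation estimate: the acceptance regions are nested in `γ`, so a
bracketing by finitely many of them suffices, uniformly in the training sample
(`exists_deviation_set`). -/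

namespace KnnPR

/-! ### Vote counts and the geometry of the kNN ball -/

open Classical in
theorem count_eq_card {E : Type*} {n : ℕ} (A : Fin n → E) (B : Set E) :
    count A B = (Finset.univ.filter fun i => A i ∈ B).card := rfl

theorem count_mono {E : Type*} {n : ℕ} (A : Fin n → E) {B C : Set E} (h : B ⊆ C) :
    count A B ≤ count A C :=
  Finset.card_le_card fun i hi => by
    simp only [Finset.mem_filter, Finset.mem_univ, true_and] at hi ⊢
    exact h hi

theorem count_le {E : Type*} {n : ℕ} (A : Fin n → E) (B : Set E) : count A B ≤ n :=
  (Finset.card_le_univ _).trans (by simp)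

theorem count_eq_sum {E : Type*} {n : ℕ} (A : Fin n → E) (B : Set E) :
    (count A B : ℝ) = ∑ i, B.indicator (fun _ => (1 : ℝ)) (A i) := by
  classical
  rw [count_eq_card, Finset.card_filter]
  simp [Set.indicator_apply]

theorem count_eq_zero_iff {E : Type*} {n : ℕ} (A : Fin n → E) (B : Set E) :
    count A B = 0 ↔ ∀ i, A i ∉ B := by
  classical
  simp [count, Finset.filter_eq_empty_iff]

theorem count_eq_of_forall {E : Type*} {n : ℕ} {A : Fin n → E} {B : Set E} (h : ∀ i, A i ∈ B) :
    count A B = n := by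
  classical
  simp [count, h]

section Metric

variable {E : Type*} [PseudoMetricSpace E] {n k : ℕ}

theorem card_pooled_dist_lt (s : Sample E n) (z : E) (t : ℝ) :
    (Finset.univ.filter fun j => dist (pooled s j) z < t).card
      = count s.1 (Metric.ball z t) + count s.2 (Metric.ball z t) := by
  classical
  rw [count_eq_card, count_eq_card, Finset.card_filter, Finset.card_filter, Finset.card_filter,
    Fintype.sum_sum_type]
  rfl

theorem mem_knnBall_pooled (s : Sample E n) (z w : E) :
    w ∈ knnBall k (pooled s) z ↔
      count s.1 (Metric.ball z (dist w z)) + count s.2 (Metric.ball z (dist w z)) < k := by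
  rw [← card_pooled_dist_lt]; rfl

theorem knnBall_subset_closedBall {s : Sample E n} {z : E} {r : ℝ}
    (h : k ≤ count s.1 (Metric.closedBall z r) + count s.2 (Metric.closedBall z r)) :
    knnBall k (pooled s) z ⊆ Metric.closedBall z r := by
  intro w hw
  rw [mem_knnBall_pooled] at hw
  by_contra hr
  have hsub : Metric.closedBall z r ⊆ Metric.ball z (dist w z) :=
    Metric.closedBall_subset_ball (by simpa using hr)
  have h1 := count_mono s.1 hsub
  have h2 := count_mono s.2 hsub
  omega

theorem closedBall_subset_knnBall {s : Sample E n} {z : E} {r : ℝ}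
    (h : count s.1 (Metric.ball z r) + count s.2 (Metric.ball z r) < k) :
    Metric.closedBall z r ⊆ knnBall k (pooled s) z := by
  intro w hw
  rw [mem_knnBall_pooled]
  have hsub : Metric.ball z (dist w z) ⊆ Metric.ball z r := Metric.ball_subset_ball hw
  have h1 := count_mono s.1 hsub
  have h2 := count_mono s.2 hsub
  omega

theorem knnBall_subset_ball {s : Sample E n} {z : E} {r : ℝ}
    (h : k ≤ count s.1 (Metric.ball z r) + count s.2 (Metric.ball z r)) :
    knnBall k (pooled s) z ⊆ Metric.ball z r := by
  intro w hw
  rw [mem_knnBall_pooled] at hw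
  by_contra hr
  have hsub : Metric.ball z r ⊆ Metric.ball z (dist w z) :=
    Metric.ball_subset_ball (by simpa using hr)
  have h1 := count_mono s.1 hsub
  have h2 := count_mono s.2 hsub
  omega

theorem le_count_knnBall (s : Sample E n) (z : E) (hk : k ≤ 2 * n) :
    k ≤ count s.1 (knnBall k (pooled s) z) + count s.2 (knnBall k (pooled s) z) := by
  classical
  by_cases hT : ∀ j, pooled s j ∈ knnBall k (pooled s) z
  · rw [count_eq_of_forall (A := s.1) fun i => hT (Sum.inl i),
      count_eq_of_forall (A := s.2) fun i => hT (Sum.inr i)]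
    omega
  · push Not at hT
    obtain ⟨j₀, hj₀⟩ := hT
    -- For a closest sample point outside the kNN ball, at least `k` points are strictly closer to
    -- `z`, and by minimality all of these lie inside.
    obtain ⟨j, hj, hmin⟩ := Finset.exists_min_image
      (Finset.univ.filter fun j => pooled s j ∉ knnBall k (pooled s) z)
      (fun j => dist (pooled s j) z) ⟨j₀, by simpa using hj₀⟩
    simp only [Finset.mem_filter, Finset.mem_univ, true_and] at hj hmin
    rw [mem_knnBall_pooled, not_lt] at hj
    refine hj.trans (add_le_add (Finset.card_le_card fun i hi => ?_)
      (Finset.card_le_card fun i hi => ?_)) <;>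
    simp only [Finset.mem_filter, Finset.mem_univ, true_and, Metric.mem_ball] at hi ⊢ <;>
    by_contra hc
    · exact absurd (hmin (Sum.inl i) hc) (not_le.2 hi)
    · exact absurd (hmin (Sum.inr i) hc) (not_le.2 hi)

/-- The deterministic core: `r` is a fixed radius, `PC, QC, PO, QO` are the expected counts in its
closed and open ball. If the open ball has fewer than `k` points, the kNN ball is exactly the closed
ball. Otherwise it is contained in the open ball, and since it has at least `k` of its roughly `k`
points, little is lost. Errors on the closed ball are relative to `PC + QC`, because an atom or a
heavy sphere may make that far larger than `k`. -/
theorem linear_count_knnBall_pos {s : Sample E n} {z : E} {r η c u v PC QC PO QO : ℝ}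
    (hk : 0 < k) (hkn : k ≤ 2 * n) (hη : 0 < η) (hη' : η ≤ 1 / 8) (hc : 0 < c)
    (huv : (|u| + |v|) * η ≤ c / 20)
    (hC : (1 + 4 * η) * k ≤ PC + QC) (hO : PO + QO ≤ (1 + 4 * η) * k)
    (dPC : |count s.1 (Metric.closedBall z r) - PC| ≤ η * (PC + QC))
    (dQC : |count s.2 (Metric.closedBall z r) - QC| ≤ η * (PC + QC))
    (dPO : |count s.1 (Metric.ball z r) - PO| ≤ η * k)
    (dQO : |count s.2 (Metric.ball z r) - QO| ≤ η * k)
    (lC : c * (PC + QC) ≤ u * PC + v * QC) (lO : c * (PO + QO) ≤ u * PO + v * QO) :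
    0 < u * count s.1 (knnBall k (pooled s) z) + v * count s.2 (knnBall k (pooled s) z) := by
  have hk' : (0 : ℝ) < k := by exact_mod_cast hk
  have hηk : 0 < η * k := by positivity
  have lin : ∀ x y D : ℝ, |x| ≤ D → |y| ≤ D → -((|u| + |v|) * D) ≤ u * x + v * y := by
    intro x y D hx hy
    have h1 : |u * x| ≤ |u| * D := by rw [abs_mul]; gcongr
    have h2 : |v * y| ≤ |v| * D := by rw [abs_mul]; gcongr
    have := neg_abs_le (u * x)
    have := neg_abs_le (v * y)
    linarith
  rcases lt_or_ge (count s.1 (Metric.ball z r) + count s.2 (Metric.ball z r)) k with h | h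
  · have htot : k ≤ count s.1 (Metric.closedBall z r) + count s.2 (Metric.closedBall z r) := by
      have h1 := (abs_le.1 dPC).1
      have h2 := (abs_le.1 dQC).1
      have : (k : ℝ) ≤ count s.1 (Metric.closedBall z r) + count s.2 (Metric.closedBall z r) := by
        nlinarith
      exact_mod_cast this
    have heq : knnBall k (pooled s) z = Metric.closedBall z r :=
      (knnBall_subset_closedBall htot).antisymm (closedBall_subset_knnBall h)
    rw [heq]
    have h3 := lin _ _ _ dPC dQC
    have hpos : 0 < PC + QC := lt_of_lt_of_le (by positivity) hC
    nlinarith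
  · have hsub := knnBall_subset_ball h
    have h1 : (count s.1 (knnBall k (pooled s) z) : ℝ) ≤ count s.1 (Metric.ball z r) := by
      exact_mod_cast count_mono s.1 hsub
    have h2 : (count s.2 (knnBall k (pooled s) z) : ℝ) ≤ count s.2 (Metric.ball z r) := by
      exact_mod_cast count_mono s.2 hsub
    have h3 : (k : ℝ) ≤ count s.1 (knnBall k (pooled s) z) + count s.2 (knnBall k (pooled s) z) := by
      exact_mod_cast le_count_knnBall s z hkn
    have h4 : (k : ℝ) ≤ count s.1 (Metric.ball z r) + count s.2 (Metric.ball z r) := by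
      exact_mod_cast h
    obtain ⟨p1, p2⟩ := abs_le.1 dPO
    obtain ⟨q1, q2⟩ := abs_le.1 dQO
    -- Each vote exceeds its expected open-ball count by at most `η * k`; as the votes sum to at
    -- least `k` and `PO + QO ≤ (1 + 4 * η) * k`, it falls short by at most `5 * η * k`. The 7 is
    -- slack.
    have h5 := lin (count s.1 (knnBall k (pooled s) z) - PO)
      (count s.2 (knnBall k (pooled s) z) - QO) (7 * (η * k))
      (abs_le.2 ⟨by linarith, by linarith⟩) (abs_le.2 ⟨by linarith, by linarith⟩)
    have h6 : (1 - 2 * η) * k ≤ PO + QO := by linarith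
    have h7 : (|u| + |v|) * (7 * (η * k)) ≤ 7 / 20 * c * k := by nlinarith
    have h8 : c * (3 / 4 * k) ≤ c * (PO + QO) := by
      refine mul_le_mul_of_nonneg_left ?_ hc.le
      nlinarith
    nlinarith [mul_pos hc hk']

end Metric

/-! ### Concentration of counts and measurability -/

/-- Chebyshev, with the variance bounded by the mean `n * P.real A` rather than by `n`. This matters
for balls with expected count of order `k`: the bound is then of order `1 / k`. -/
theorem meas_count_deviation_le {E : Type*} [MeasurableSpace E] (P : Measure E)
    [IsProbabilityMeasure P] (n : ℕ) {A : Set E} (hA : MeasurableSet A) {t : ℝ} (ht : 0 < t) :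
    (Measure.pi fun _ : Fin n => P) {x | t < |count x A - n * P.real A|}
      ≤ ENNReal.ofReal (n * P.real A / t ^ 2) := by
  set X : E → ℝ := A.indicator fun _ => (1 : ℝ) with hX
  have hXm : MemLp X 2 P := memLp_indicator_const 2 hA 1 (Or.inr (measure_ne_top _ _))
  have hcount : ∀ x : Fin n → E, (count x A : ℝ) = (∑ i, fun ω : Fin n → E => X (ω i)) x := by
    intro x; rw [count_eq_sum]; simp [hX]
  have hmem : MemLp (∑ i, fun ω : Fin n → E => X (ω i)) 2 (Measure.pi fun _ : Fin n => P) :=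
    memLp_finsetSum' _ fun i _ => hXm.comp_measurePreserving (measurePreserving_eval _ i)
  have hint : (∫ x, (∑ i, fun ω : Fin n → E => X (ω i)) x ∂(Measure.pi fun _ : Fin n => P))
      = n * P.real A := by
    simp only [Finset.sum_apply]
    rw [integral_finsetSum (f := fun (i : Fin n) (ω : Fin n → E) => X (ω i)) _ fun i _ =>
      (hXm.comp_measurePreserving (measurePreserving_eval (fun _ : Fin n => P) i)).integrable
        one_le_two]
    have : ∀ i : Fin n, ∫ x : Fin n → E, X (x i) ∂(Measure.pi fun _ : Fin n => P) = P.real A := by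
      intro i
      rw [integral_comp_eval (μ := fun _ : Fin n => P) (i := i) (f := X) hXm.1]
      simp [hX, integral_indicator_const _ hA]
    simp [this]
  have hvar : ProbabilityTheory.variance (∑ i, fun ω : Fin n → E => X (ω i))
      (Measure.pi fun _ : Fin n => P) ≤ n * P.real A := by
    rw [ProbabilityTheory.variance_sum_pi (X := fun _ => X) fun _ => hXm]
    have : ProbabilityTheory.variance X P ≤ P.real A := by
      refine (ProbabilityTheory.variance_le_expectation_sq hXm.1).trans (le_of_eq ?_)
      have : X ^ 2 = X := by
        ext x; by_cases hx : x ∈ A <;> simp [hX, hx]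
      rw [this, hX, integral_indicator_const _ hA]
      simp
    simpa using mul_le_mul_of_nonneg_left this (Nat.cast_nonneg n)
  refine (measure_mono fun x hx => ?_).trans
    ((ProbabilityTheory.meas_ge_le_variance_div_sq hmem ht).trans
      (ENNReal.ofReal_le_ofReal (by gcongr)))
  simp only [Set.mem_ofPred_eq] at hx ⊢
  rw [hint, ← hcount]
  exact hx.le

theorem sampleLaw_fst_preimage {E : Type*} [MeasurableSpace E] (P Q : Measure E)
    [IsProbabilityMeasure P] [IsProbabilityMeasure Q] {n : ℕ} (A : Set (Fin n → E)) :
    sampleLaw P Q n {s | s.1 ∈ A} = (Measure.pi fun _ : Fin n => P) A := by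
  have : {s : Sample E n | s.1 ∈ A} = A ×ˢ Set.univ := by ext; simp
  rw [this, sampleLaw, Measure.prod_prod]; simp

theorem sampleLaw_snd_preimage {E : Type*} [MeasurableSpace E] (P Q : Measure E)
    [IsProbabilityMeasure P] [IsProbabilityMeasure Q] {n : ℕ} (A : Set (Fin n → E)) :
    sampleLaw P Q n {s | s.2 ∈ A} = (Measure.pi fun _ : Fin n => Q) A := by
  have : {s : Sample E n | s.2 ∈ A} = Set.univ ×ˢ A := by ext; simp
  rw [this, sampleLaw, Measure.prod_prod]; simp

instance {E : Type*} [MeasurableSpace E] (P Q : Measure E)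
    [IsProbabilityMeasure P] [IsProbabilityMeasure Q] (n : ℕ) :
    IsProbabilityMeasure (sampleLaw P Q n) := by
  unfold sampleLaw; infer_instance

theorem measurable_pooled_apply {E : Type*} [MeasurableSpace E] {n : ℕ} (j : Fin n ⊕ Fin n) :
    Measurable fun s : Sample E n => pooled s j := by
  cases j <;> simp only [pooled, Sum.elim_inl, Sum.elim_inr] <;> fun_prop

/-- The vote counts `(a, b)` at which the classifier with parameter `γ` predicts `1`. -/
def acceptSet (γ : ℝ≥0∞) : Set (ℕ × ℕ) :=
  {q | (1 ≤ γ ∧ (q.2 : ℝ≥0∞) ≤ γ * (q.1 : ℝ≥0∞)) ∨ (γ < 1 ∧ (q.2 : ℝ≥0∞) < γ * (q.1 : ℝ≥0∞))}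

/-- The numbers of points of both parts of a sample in the nearest-neighbour ball. -/
noncomputable def votes {E : Type*} [PseudoMetricSpace E] {n : ℕ} (k : ℕ) (s : Sample E n) (z : E) : ℕ × ℕ :=
  (count s.1 (knnBall k (pooled s) z), count s.2 (knnBall k (pooled s) z))

theorem knnClassifier_eq_indicator {E : Type*} [PseudoMetricSpace E] {n : ℕ} (k : ℕ) (γ : ℝ≥0∞)
    (s : Sample E n) (z : E) :
    knnClassifier k γ s z = (acceptSet γ).indicator (fun _ => 1) (votes k s z) := by
  classical
  rw [Set.indicator_apply, knnClassifier]
  congr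

section Measurability

variable {E : Type*} [PseudoMetricSpace E] [SecondCountableTopology E] [MeasurableSpace E]
  [BorelSpace E] {n : ℕ}

theorem measurable_card_filter {α ι : Type*} [MeasurableSpace α] [Fintype ι] {p : ι → α → Prop}
    [∀ i x, Decidable (p i x)] (h : ∀ i, MeasurableSet {x | p i x}) :
    Measurable fun x => (Finset.univ.filter fun i => p i x).card := by
  simp only [Finset.card_filter]
  exact Finset.measurable_sum _ fun i _ =>
    Measurable.ite (h i) measurable_const measurable_const

theorem measurableSet_mem_knnBall (k : ℕ) :
    MeasurableSet {x : Sample E n × E × E | x.2.2 ∈ knnBall k (pooled x.1) x.2.1} := by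
  have : Measurable fun x : Sample E n × E × E =>
      (Finset.univ.filter fun j => dist (pooled x.1 j) x.2.1 < dist x.2.2 x.2.1).card := by
    refine measurable_card_filter fun j => ?_
    have := measurable_pooled_apply (E := E) j
    exact measurableSet_lt ((this.comp measurable_fst).dist (by fun_prop)) (by fun_prop)
  exact this (measurableSet_Iio (a := k))

theorem measurable_count_fst_knnBall (k : ℕ) :
    Measurable fun x : Sample E n × E => count x.1.1 (knnBall k (pooled x.1) x.2) := by
  classical
  refine measurable_card_filter fun i => ?_
  have : Measurable fun x : Sample E n × E => (x.1, x.2, x.1.1 i) := by fun_prop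
  exact this (measurableSet_mem_knnBall k)

theorem measurable_count_snd_knnBall (k : ℕ) :
    Measurable fun x : Sample E n × E => count x.1.2 (knnBall k (pooled x.1) x.2) := by
  classical
  refine measurable_card_filter fun i => ?_
  have : Measurable fun x : Sample E n × E => (x.1, x.2, x.1.2 i) := by fun_prop
  exact this (measurableSet_mem_knnBall k)

theorem measurable_knnClassifier (k : ℕ) (γ : ℝ≥0∞) :
    Measurable fun x : Sample E n × E => knnClassifier k γ x.1 x.2 := by
  have h : Measurable fun x : Sample E n × E => votes k x.1 x.2 :=
    (measurable_count_fst_knnBall k).prodMk (measurable_count_snd_knnBall k)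
  have h2 : Measurable ((acceptSet γ).indicator fun _ => (1 : ℝ≥0∞)) := measurable_of_countable _
  simp only [knnClassifier_eq_indicator]
  exact h2.comp h

end Measurability

theorem knnClassifier_eq_zero_or_one {E : Type*} [PseudoMetricSpace E] {n : ℕ} (k : ℕ) (γ : ℝ≥0∞)
    (s : Sample E n) (z : E) : knnClassifier k γ s z = 0 ∨ knnClassifier k γ s z = 1 := by
  rw [knnClassifier_eq_indicator]
  exact Set.indicator_eq_zero_or_self _ _ _

theorem knnClassifier_le_one {E : Type*} [PseudoMetricSpace E] {n : ℕ} (k : ℕ) (γ : ℝ≥0∞)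
    (s : Sample E n) (z : E) : knnClassifier k γ s z ≤ 1 := by
  rcases knnClassifier_eq_zero_or_one k γ s z with h | h <;> simp [h]

/-! ### Quantile radii and the limit regime -/

section Balls

variable {E : Type*} [PseudoMetricSpace E] [MeasurableSpace E]

theorem tendsto_measureReal_closedBall_add [OpensMeasurableSpace E] (μ : Measure E) [IsFiniteMeasure μ] (z : E) (r : ℝ) :
    Tendsto (fun m : ℕ => μ.real (Metric.closedBall z (r + 1 / ((m : ℝ) + 1)))) atTop
      (𝓝 (μ.real (Metric.closedBall z r))) := by
  have h : Metric.closedBall z r = ⋂ m : ℕ, Metric.closedBall z (r + 1 / ((m : ℝ) + 1)) := by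
    ext w
    simp only [Metric.mem_closedBall, Set.mem_iInter]
    refine ⟨fun hw m => hw.trans (by simp; positivity), fun hw => ?_⟩
    have : Tendsto (fun m : ℕ => r + 1 / ((m : ℝ) + 1)) atTop (𝓝 (r + 0)) :=
      tendsto_const_nhds.add tendsto_one_div_add_atTop_nhds_zero_nat
    simpa using ge_of_tendsto' this hw
  have hanti : Antitone fun m : ℕ => Metric.closedBall z (r + 1 / ((m : ℝ) + 1)) := by
    intro a b hab
    refine Metric.closedBall_subset_closedBall ?_
    gcongr
  rw [measureReal_def, h]
  exact (ENNReal.tendsto_toReal (measure_ne_top _ _)).comp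
    (tendsto_measure_iInter_atTop (fun _ => Metric.isClosed_closedBall.nullMeasurableSet) hanti
      ⟨0, measure_ne_top _ _⟩)

theorem tendsto_measureReal_closedBall_sub (μ : Measure E) [IsFiniteMeasure μ] (z : E) (r : ℝ) :
    Tendsto (fun m : ℕ => μ.real (Metric.closedBall z (r - 1 / ((m : ℝ) + 1)))) atTop
      (𝓝 (μ.real (Metric.ball z r))) := by
  have h : Metric.ball z r = ⋃ m : ℕ, Metric.closedBall z (r - 1 / ((m : ℝ) + 1)) := by
    ext w
    simp only [Metric.mem_closedBall, Metric.mem_ball, Set.mem_iUnion]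
    constructor
    · intro hw
      obtain ⟨m, hm⟩ := exists_nat_one_div_lt (sub_pos.2 hw)
      exact ⟨m, by linarith⟩
    · rintro ⟨m, hm⟩
      have : (0 : ℝ) < 1 / ((m : ℝ) + 1) := by positivity
      linarith
  have hmono : Monotone fun m : ℕ => Metric.closedBall z (r - 1 / ((m : ℝ) + 1)) := by
    intro a b hab
    refine Metric.closedBall_subset_closedBall ?_
    gcongr
  rw [measureReal_def, h]
  exact (ENNReal.tendsto_toReal (measure_ne_top _ _)).comp
    (tendsto_measure_iUnion_atTop hmono)

/-- The infimum of the radii whose closed ball has mass at least `K` works: closed balls are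
continuous from the right in the radius, and the open ball is the increasing union of smaller closed
balls. A charged sphere may separate the two masses. -/
theorem exists_quantile_radius [OpensMeasurableSpace E] (μ : Measure E) [IsFiniteMeasure μ] (z : E) {ρ K : ℝ} (hK : 0 < K)
    (h : K ≤ μ.real (Metric.closedBall z ρ)) :
    ∃ r, 0 ≤ r ∧ r ≤ ρ ∧ K ≤ μ.real (Metric.closedBall z r) ∧ μ.real (Metric.ball z r) ≤ K := by
  set T : Set ℝ := {r | K ≤ μ.real (Metric.closedBall z r)} with hT
  have hnonneg : ∀ r ∈ T, 0 ≤ r := by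
    intro r hr
    by_contra hneg
    rw [hT, Set.mem_ofPred_eq, Metric.closedBall_eq_empty.2 (not_le.1 hneg)] at hr
    simp at hr
    linarith
  have hbdd : BddBelow T := ⟨0, hnonneg⟩
  have hne : T.Nonempty := ⟨ρ, h⟩
  refine ⟨sInf T, le_csInf hne hnonneg, csInf_le hbdd h, ?_, ?_⟩
  · refine ge_of_tendsto' (tendsto_measureReal_closedBall_add μ z (sInf T)) fun m => ?_
    obtain ⟨r, hr, hlt⟩ := exists_lt_of_csInf_lt hne
      (show sInf T < sInf T + 1 / ((m : ℝ) + 1) by simp; positivity)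
    exact le_trans hr (measureReal_mono (Metric.closedBall_subset_closedBall hlt.le))
  · refine le_of_tendsto' (tendsto_measureReal_closedBall_sub μ z (sInf T)) fun m => ?_
    by_contra hc
    have := csInf_le hbdd (show sInf T - 1 / ((m : ℝ) + 1) ∈ T from (not_le.1 hc).le)
    have : (0 : ℝ) < 1 / ((m : ℝ) + 1) := by positivity
    linarith

end Balls

theorem eventually_regime_fst (K : ℕ) : ∀ᶠ p in regime, K ≤ p.1 :=
  (tendsto_comap.mono_left (inf_le_left.trans inf_le_left) :
    Tendsto Prod.fst regime atTop).eventually_ge_atTop K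

theorem eventually_regime_snd (K : ℕ) : ∀ᶠ p in regime, K ≤ p.2 :=
  (tendsto_comap.mono_left (inf_le_left.trans inf_le_right) :
    Tendsto Prod.snd regime atTop).eventually_ge_atTop K

theorem eventually_regime_le_mul {c : ℝ} (hc : 0 < c) :
    ∀ᶠ p in regime, (p.1 : ℝ) ≤ c * p.2 := by
  have h : Tendsto (fun p : ℕ × ℕ => (p.1 : ℝ) / (p.2 : ℝ)) regime (𝓝 0) :=
    tendsto_comap.mono_left inf_le_right
  filter_upwards [h.eventually_le_const hc, eventually_regime_snd 1] with p hp hn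
  rwa [div_le_iff₀ (by exact_mod_cast hn)] at hp

theorem eventually_regime_le : ∀ᶠ p in regime, 1 ≤ p.1 ∧ p.1 ≤ p.2 := by
  filter_upwards [eventually_regime_fst 1, eventually_regime_le_mul one_pos] with p h1 h2
  exact ⟨h1, by rw [one_mul] at h2; exact_mod_cast h2⟩

theorem tendsto_regime_ofReal_div (C : ℝ) :
    Tendsto (fun p : ℕ × ℕ => ENNReal.ofReal (C / p.1)) regime (𝓝 0) := by
  have h : Tendsto (Prod.fst : ℕ × ℕ → ℕ) regime atTop :=
    tendsto_comap.mono_left (inf_le_left.trans inf_le_left)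
  have := ENNReal.tendsto_ofReal ((tendsto_const_div_atTop_nhds_zero_nat C).comp h)
  simpa using this

/-- At the radius where `n * (P + Q)` crosses `(1 + 4 * η) * k`, four Chebyshev events of total
probability `O(1 / k)` contain all samples that violate `linear_count_knnBall_pos`. -/
theorem tendsto_prob_linear_votes {E : Type*} [PseudoMetricSpace E] [MeasurableSpace E]
    [OpensMeasurableSpace E] (P Q : Measure E) [IsProbabilityMeasure P] [IsProbabilityMeasure Q]
    (z : E) {c ρ u v : ℝ} (hc : 0 < c) (hρ : 0 < ρ)
    (hlin : ∀ r, 0 < r → r ≤ ρ →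
      c * (P.real (Metric.closedBall z r) + Q.real (Metric.closedBall z r))
        ≤ u * P.real (Metric.closedBall z r) + v * Q.real (Metric.closedBall z r))
    (hpos : 0 < (P + Q).real (Metric.closedBall z (ρ / 2))) :
    Tendsto (fun p : ℕ × ℕ => sampleLaw P Q p.2
      {s | ¬ 0 < u * (votes p.1 s z).1 + v * (votes p.1 s z).2}) regime (𝓝 0) := by
  obtain ⟨η, hη, hη', huv⟩ : ∃ η : ℝ, 0 < η ∧ η ≤ 1 / 8 ∧ (|u| + |v|) * η ≤ c / 20 := by
    refine ⟨min (1 / 8) (c / 20 / (|u| + |v| + 1)), by positivity, min_le_left _ _, ?_⟩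
    calc (|u| + |v|) * min (1 / 8) (c / 20 / (|u| + |v| + 1))
        ≤ (|u| + |v| + 1) * (c / 20 / (|u| + |v| + 1)) :=
          mul_le_mul (by linarith) (min_le_right _ _) (by positivity) (by positivity)
      _ = c / 20 := by field_simp
  have hadd : ∀ A : Set E, (P + Q).real A = P.real A + Q.real A := fun A => measureReal_add_apply
  -- Radius `0` must be included, since the quantile radius vanishes when `z` is a sufficiently
  -- heavy atom; open balls follow by a limit as well.
  have hlinC : ∀ r, 0 ≤ r → r ≤ ρ / 2 →
      c * (P.real (Metric.closedBall z r) + Q.real (Metric.closedBall z r))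
        ≤ u * P.real (Metric.closedBall z r) + v * Q.real (Metric.closedBall z r) := by
    intro r h0 hr
    rcases h0.eq_or_lt with rfl | h0
    · have hP := tendsto_measureReal_closedBall_add P z 0
      have hQ := tendsto_measureReal_closedBall_add Q z 0
      refine le_of_tendsto_of_tendsto ((hP.add hQ).const_mul c)
        ((hP.const_mul u).add (hQ.const_mul v)) ?_
      have : ∀ᶠ m : ℕ in atTop, (1 : ℝ) / ((m : ℝ) + 1) ≤ ρ :=
        tendsto_one_div_add_atTop_nhds_zero_nat.eventually_le_const hρ
      filter_upwards [this] with m hm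
      exact hlin _ (by positivity) (by simpa using hm)
    · exact hlin r h0 (by linarith)
  have hlinO : ∀ r, 0 ≤ r → r ≤ ρ / 2 →
      c * (P.real (Metric.ball z r) + Q.real (Metric.ball z r))
        ≤ u * P.real (Metric.ball z r) + v * Q.real (Metric.ball z r) := by
    intro r h0 hr
    have hP := tendsto_measureReal_closedBall_sub P z r
    have hQ := tendsto_measureReal_closedBall_sub Q z r
    refine le_of_tendsto_of_tendsto' ((hP.add hQ).const_mul c)
      ((hP.const_mul u).add (hQ.const_mul v)) fun m => ?_
    have h1 : (0 : ℝ) < 1 / ((m : ℝ) + 1) := by positivity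
    rcases le_or_gt 0 (r - 1 / ((m : ℝ) + 1)) with h | h
    · exact hlinC _ h (by linarith)
    · rw [Metric.closedBall_eq_empty.2 h]; simp
  refine tendsto_of_tendsto_of_tendsto_of_le_of_le' tendsto_const_nhds
    (tendsto_regime_ofReal_div (6 / η ^ 2)) (Eventually.of_forall fun _ => zero_le) ?_
  filter_upwards [eventually_regime_le, eventually_regime_le_mul
    (show 0 < (P + Q).real (Metric.closedBall z (ρ / 2)) / (1 + 4 * η) by positivity)]
    with ⟨k, n⟩ ⟨hk, hkn⟩ hKn
  dsimp only at hk hkn hKn ⊢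
  have hk' : (0 : ℝ) < k := by exact_mod_cast hk
  have hn' : (0 : ℝ) < n := by exact_mod_cast hk.trans hkn
  obtain ⟨r, hr0, hr, hC, hO⟩ := exists_quantile_radius (P + Q) z (ρ := ρ / 2)
    (K := (1 + 4 * η) * k / n) (by positivity) (by
      rw [div_le_iff₀ hn']
      calc (1 + 4 * η) * k
          ≤ (1 + 4 * η) * ((P + Q).real (Metric.closedBall z (ρ / 2)) / (1 + 4 * η) * n) := by
            gcongr
        _ = _ := by field_simp)
  rw [div_le_iff₀ hn', hadd] at hC
  rw [le_div_iff₀ hn', hadd] at hO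
  set C := Metric.closedBall z r with hCdef
  set O := Metric.ball z r with hOdef
  have hCm : MeasurableSet C := Metric.isClosed_closedBall.measurableSet
  have hOm : MeasurableSet O := Metric.isOpen_ball.measurableSet
  set M : ℝ := n * P.real C + n * Q.real C with hM
  have hkM : (k : ℝ) ≤ M := by
    have : 0 < η * k := by positivity
    nlinarith
  have hM0 : 0 < M := hk'.trans_le hkM
  have hO2 : n * P.real O + n * Q.real O ≤ 2 * k := by nlinarith
  have hPC : 0 ≤ n * P.real C := by positivity
  have hQC : 0 ≤ n * Q.real C := by positivity
  have hPO : 0 ≤ n * P.real O := by positivity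
  have hQO : 0 ≤ n * Q.real O := by positivity
  have b1 : ∀ x : ℝ, x ≤ M → x / (η * M) ^ 2 ≤ 1 / η ^ 2 / k := by
    intro x hx
    calc x / (η * M) ^ 2 ≤ M / (η * M) ^ 2 := by gcongr
      _ = 1 / η ^ 2 / M := by field_simp
      _ ≤ 1 / η ^ 2 / k := by gcongr
  have b2 : ∀ x : ℝ, x ≤ 2 * k → x / (η * k) ^ 2 ≤ 2 / η ^ 2 / k := by
    intro x hx
    calc x / (η * k) ^ 2 ≤ 2 * k / (η * k) ^ 2 := by gcongr
      _ = 2 / η ^ 2 / k := by field_simp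
  set B1 : Set (Sample E n) := {s | s.1 ∈ {x | η * M < |count x C - n * P.real C|}}
  set B2 : Set (Sample E n) := {s | s.2 ∈ {x | η * M < |count x C - n * Q.real C|}}
  set B3 : Set (Sample E n) := {s | s.1 ∈ {x | η * k < |count x O - n * P.real O|}}
  set B4 : Set (Sample E n) := {s | s.2 ∈ {x | η * k < |count x O - n * Q.real O|}}
  have e1 : sampleLaw P Q n B1 ≤ ENNReal.ofReal (1 / η ^ 2 / k) := by
    rw [sampleLaw_fst_preimage]
    exact (meas_count_deviation_le P n hCm (by positivity)).trans
      (ENNReal.ofReal_le_ofReal (b1 _ (by linarith)))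
  have e2 : sampleLaw P Q n B2 ≤ ENNReal.ofReal (1 / η ^ 2 / k) := by
    rw [sampleLaw_snd_preimage]
    exact (meas_count_deviation_le Q n hCm (by positivity)).trans
      (ENNReal.ofReal_le_ofReal (b1 _ (by linarith)))
  have e3 : sampleLaw P Q n B3 ≤ ENNReal.ofReal (2 / η ^ 2 / k) := by
    rw [sampleLaw_fst_preimage]
    exact (meas_count_deviation_le P n hOm (by positivity)).trans
      (ENNReal.ofReal_le_ofReal (b2 _ (by linarith)))
  have e4 : sampleLaw P Q n B4 ≤ ENNReal.ofReal (2 / η ^ 2 / k) := by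
    rw [sampleLaw_snd_preimage]
    exact (meas_count_deviation_le Q n hOm (by positivity)).trans
      (ENNReal.ofReal_le_ofReal (b2 _ (by linarith)))
  have hsub : {s : Sample E n | ¬ 0 < u * (votes k s z).1 + v * (votes k s z).2}
      ⊆ (B1 ∪ B2) ∪ (B3 ∪ B4) := by
    intro s hs
    by_contra hB
    simp only [Set.mem_union, not_or] at hB
    obtain ⟨⟨h1, h2⟩, h3, h4⟩ := hB
    refine hs (linear_count_knnBall_pos hk (by omega) hη hη' hc huv (r := r)
      (PC := n * P.real C) (QC := n * Q.real C) (PO := n * P.real O) (QO := n * Q.real O)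
      (by linarith) (by linarith) (not_lt.1 h1) (not_lt.1 h2) (not_lt.1 h3) (not_lt.1 h4) ?_ ?_)
    · have := mul_le_mul_of_nonneg_left (hlinC r hr0 hr) hn'.le
      nlinarith
    · have := mul_le_mul_of_nonneg_left (hlinO r hr0 hr) hn'.le
      nlinarith
  calc _ ≤ sampleLaw P Q n ((B1 ∪ B2) ∪ (B3 ∪ B4)) := measure_mono hsub
    _ ≤ (sampleLaw P Q n B1 + sampleLaw P Q n B2) + (sampleLaw P Q n B3 + sampleLaw P Q n B4) :=
      (measure_union_le _ _).trans
        (add_le_add (measure_union_le _ _) (measure_union_le _ _))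
    _ ≤ (ENNReal.ofReal (1 / η ^ 2 / k) + ENNReal.ofReal (1 / η ^ 2 / k)) +
        (ENNReal.ofReal (2 / η ^ 2 / k) + ENNReal.ofReal (2 / η ^ 2 / k)) := by gcongr
    _ = ENNReal.ofReal (6 / η ^ 2 / k) := by
      rw [← ENNReal.ofReal_add (by positivity) (by positivity),
        ← ENNReal.ofReal_add (by positivity) (by positivity),
        ← ENNReal.ofReal_add (by positivity) (by positivity)]
      congr 1; ring

instance : regime.IsCountablyGenerated := by unfold regime; infer_instance

/-! ### The decision rule and its acceptance probabilities -/

theorem mem_acceptSet_of_lt {lam : ℝ≥0∞} {q : ℕ × ℕ} (h : (q.2 : ℝ≥0∞) < lam * q.1) :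
    q ∈ acceptSet lam :=
  (le_or_gt 1 lam).imp (fun h1 => ⟨h1, h.le⟩) fun h1 => ⟨h1, h⟩

theorem notMem_acceptSet_of_lt {lam : ℝ≥0∞} {q : ℕ × ℕ} (h : lam * q.1 < (q.2 : ℝ≥0∞)) :
    q ∉ acceptSet lam := by
  rintro (⟨-, h1⟩ | ⟨-, h1⟩)
  · exact absurd h1 (not_le.2 h)
  · exact absurd h1 h.not_gt

/-- The tie convention is compatible with monotonicity: ties are rejected below `1` and accepted
from `1` on. The nesting drives the bracketing of the validation error. -/
theorem acceptSet_mono {γ γ' : ℝ≥0∞} (h : γ ≤ γ') : acceptSet γ ⊆ acceptSet γ' := by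
  rintro q (⟨h1, h2⟩ | ⟨h1, h2⟩)
  · exact Or.inl ⟨h1.trans h, h2.trans (mul_le_mul_left h _)⟩
  · exact mem_acceptSet_of_lt (h2.trans_le (mul_le_mul_left h _))

theorem natCast_lt_mul_iff {lam : ℝ≥0∞} (hlam : lam ≠ ∞) {a b : ℕ} :
    (b : ℝ≥0∞) < lam * a ↔ (b : ℝ) < lam.toReal * a := by
  rw [← ENNReal.toReal_lt_toReal (ENNReal.natCast_ne_top _)
    (ENNReal.mul_ne_top hlam (ENNReal.natCast_ne_top _))]
  simp

theorem mul_lt_natCast_iff {lam : ℝ≥0∞} (hlam : lam ≠ ∞) {a b : ℕ} :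
    lam * a < (b : ℝ≥0∞) ↔ lam.toReal * a < (b : ℝ) := by
  rw [← ENNReal.toReal_lt_toReal (ENNReal.mul_ne_top hlam (ENNReal.natCast_ne_top _))
    (ENNReal.natCast_ne_top _)]
  simp

section Prob

variable {E : Type*} [PseudoMetricSpace E] [MeasurableSpace E] (P Q : Measure E)

/-- Probability, over the training sample, that the classifier takes the value `1` at `z`. -/
noncomputable def acceptProb (γ : ℝ≥0∞) (k n : ℕ) (z : E) : ℝ≥0∞ :=
  ∫⁻ s, knnClassifier k γ s z ∂(sampleLaw P Q n)

/-- Probability, over the training sample, that the classifier takes the value `0` at `z`. -/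
noncomputable def rejectProb (γ : ℝ≥0∞) (k n : ℕ) (z : E) : ℝ≥0∞ :=
  ∫⁻ s, (1 - knnClassifier k γ s z) ∂(sampleLaw P Q n)

theorem acceptProb_le_of_subset {γ : ℝ≥0∞} {k n : ℕ} {z : E} {B : Set (Sample E n)}
    (h : ∀ s, s ∉ B → votes k s z ∉ acceptSet γ) :
    acceptProb P Q γ k n z ≤ sampleLaw P Q n B := by
  refine le_trans (lintegral_mono fun s => ?_) (lintegral_indicator_one_le B)
  by_cases hs : s ∈ B
  · simpa [hs] using knnClassifier_le_one k γ s z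
  · simp [knnClassifier_eq_indicator, h s hs]

theorem rejectProb_le_of_subset {γ : ℝ≥0∞} {k n : ℕ} {z : E} {B : Set (Sample E n)}
    (h : ∀ s, s ∉ B → votes k s z ∈ acceptSet γ) :
    rejectProb P Q γ k n z ≤ sampleLaw P Q n B := by
  refine le_trans (lintegral_mono fun s => ?_) (lintegral_indicator_one_le B)
  by_cases hs : s ∈ B
  · simp [hs]
  · simp [knnClassifier_eq_indicator, h s hs]

end Prob

section Swap

variable {E : Type*} [PseudoMetricSpace E] [SecondCountableTopology E] [MeasurableSpace E]
  [BorelSpace E]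

theorem measurable_knnClassifier_left {n : ℕ} (k : ℕ) (γ : ℝ≥0∞) (z : E) :
    Measurable fun s : Sample E n => knnClassifier k γ s z :=
  Measurable.comp (g := fun x : Sample E n × E => knnClassifier k γ x.1 x.2) (f := fun s => (s, z))
    (measurable_knnClassifier k γ) measurable_prodMk_right

theorem measurable_knnClassifier_right {n : ℕ} (k : ℕ) (γ : ℝ≥0∞) (s : Sample E n) :
    Measurable fun z : E => knnClassifier k γ s z :=
  Measurable.comp (g := fun x : Sample E n × E => knnClassifier k γ x.1 x.2) (f := fun z => (s, z))
    (measurable_knnClassifier k γ) measurable_prodMk_left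

variable (P Q : Measure E) [IsProbabilityMeasure P] [IsProbabilityMeasure Q]

theorem measurable_acceptProb (γ : ℝ≥0∞) (k n : ℕ) : Measurable (acceptProb P Q γ k n) :=
  (measurable_knnClassifier k γ).lintegral_prod_left'

theorem measurable_rejectProb (γ : ℝ≥0∞) (k n : ℕ) : Measurable (rejectProb P Q γ k n) :=
  (measurable_const.sub (measurable_knnClassifier k γ)).lintegral_prod_left'

theorem rejectProb_add_acceptProb (γ : ℝ≥0∞) (k n : ℕ) (z : E) :
    rejectProb P Q γ k n z + acceptProb P Q γ k n z = 1 := by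
  rw [rejectProb, acceptProb, ← lintegral_add_right _ (measurable_knnClassifier_left k γ z)]
  simp [tsub_add_cancel_of_le (knnClassifier_le_one k γ _ z)]

theorem rejectProb_le_one (γ : ℝ≥0∞) (k n : ℕ) (z : E) : rejectProb P Q γ k n z ≤ 1 :=
  (rejectProb_add_acceptProb P Q γ k n z) ▸ le_self_add

theorem acceptProb_le_one (γ : ℝ≥0∞) (k n : ℕ) (z : E) : acceptProb P Q γ k n z ≤ 1 :=
  (rejectProb_add_acceptProb P Q γ k n z) ▸ le_add_self

theorem lintegral_fpr (γ : ℝ≥0∞) (k n : ℕ) :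
    ∫⁻ s, fpr P (knnClassifier k γ s) ∂(sampleLaw P Q n) = ∫⁻ z, rejectProb P Q γ k n z ∂P := by
  unfold fpr rejectProb
  exact lintegral_lintegral_swap (measurable_const.sub (measurable_knnClassifier k γ)).aemeasurable

theorem lintegral_fnr (γ : ℝ≥0∞) (k n : ℕ) :
    ∫⁻ s, fnr Q (knnClassifier k γ s) ∂(sampleLaw P Q n) = ∫⁻ z, acceptProb P Q γ k n z ∂Q := by
  unfold fnr acceptProb
  exact lintegral_lintegral_swap (measurable_knnClassifier k γ).aemeasurable

theorem expectedRisk_eq (lam γ : ℝ≥0∞) (k n : ℕ) :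
    expectedRisk P Q lam γ k n =
      lam * ∫⁻ z, rejectProb P Q γ k n z ∂P + ∫⁻ z, acceptProb P Q γ k n z ∂Q := by
  have h1 : Measurable fun s : Sample E n => fpr P (knnClassifier k γ s) :=
    (measurable_const.sub (measurable_knnClassifier k γ)).lintegral_prod_right'
  unfold expectedRisk risk
  rw [lintegral_add_left (h1.const_mul _), lintegral_const_mul _ h1, lintegral_fpr, lintegral_fnr]

end Swap

/-! ### The precision as the Bayes risk -/

section Alpha

variable {E : Type*} [MeasurableSpace E] (P Q : Measure E)

/-- Split `1 = (1 - f) + f` under the minimum measure, then bound that measure by `lam • P` in one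
term and by `Q` in the other. -/
theorem alpha_le_risk {lam : ℝ≥0∞} {f : E → ℝ≥0∞} (hf : Measurable f) (hf1 : ∀ z, f z ≤ 1) :
    alpha P Q lam ≤ risk P Q lam f := by
  calc alpha P Q lam = ∫⁻ z, ((1 - f z) + f z) ∂(lam • P ⊓ Q) := by
        simp [tsub_add_cancel_of_le (hf1 _), alpha]
    _ = ∫⁻ z, (1 - f z) ∂(lam • P ⊓ Q) + ∫⁻ z, f z ∂(lam • P ⊓ Q) := lintegral_add_right _ hf
    _ ≤ ∫⁻ z, (1 - f z) ∂(lam • P) + ∫⁻ z, f z ∂Q :=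
      add_le_add (lintegral_mono' inf_le_left le_rfl) (lintegral_mono' inf_le_right le_rfl)
    _ = risk P Q lam f := by rw [lintegral_smul_measure]; rfl

theorem absolutelyContinuous_add_left : P ≪ P + Q :=
  Measure.absolutelyContinuous_of_le (Measure.le_add_right le_rfl)

theorem absolutelyContinuous_add_right : Q ≪ P + Q :=
  Measure.absolutelyContinuous_of_le (Measure.le_add_left le_rfl)

/-- One inequality tests `alpha_le_risk` on the Bayes classifier; the other holds because the
measure with density `min (lam * p) q` lies below both `lam • P` and `Q`. -/
theorem alpha_eq_lintegral_min [IsFiniteMeasure P] [IsFiniteMeasure Q] {lam : ℝ≥0∞} :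
    alpha P Q lam = ∫⁻ z, min (lam * P.rnDeriv (P + Q) z) (Q.rnDeriv (P + Q) z) ∂(P + Q) := by
  set p := P.rnDeriv (P + Q)
  set q := Q.rnDeriv (P + Q)
  have hp : Measurable p := Measure.measurable_rnDeriv _ _
  have hq : Measurable q := Measure.measurable_rnDeriv _ _
  have hP : (P + Q).withDensity p = P :=
    Measure.withDensity_rnDeriv_eq _ _ (absolutelyContinuous_add_left P Q)
  have hQ : (P + Q).withDensity q = Q :=
    Measure.withDensity_rnDeriv_eq _ _ (absolutelyContinuous_add_right P Q)
  apply le_antisymm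
  · classical
    set A : Set E := {z | q z < lam * p z}
    have hA : MeasurableSet A := measurableSet_lt hq (hp.const_mul _)
    refine (alpha_le_risk P Q (f := A.indicator fun _ => 1) (measurable_const.indicator hA)
      fun z => Set.indicator_le_self' (fun _ _ => zero_le) z).trans ?_
    have hA1 : Measurable (A.indicator fun _ => (1 : ℝ≥0∞)) := measurable_const.indicator hA
    have hA0 : Measurable fun z => 1 - A.indicator (fun _ => (1 : ℝ≥0∞)) z :=
      measurable_const.sub hA1
    have hpA : Measurable fun z => p z * (1 - A.indicator (fun _ => (1 : ℝ≥0∞)) z) := hp.mul hA0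
    have hqA : Measurable fun z => q z * A.indicator (fun _ => (1 : ℝ≥0∞)) z := hq.mul hA1
    unfold risk fpr fnr
    rw [← lintegral_rnDeriv_mul (absolutelyContinuous_add_left P Q) hA0.aemeasurable,
      ← lintegral_rnDeriv_mul (absolutelyContinuous_add_right P Q) hA1.aemeasurable,
      ← lintegral_const_mul _ hpA, ← lintegral_add_right _ hqA]
    refine lintegral_mono fun z => ?_
    by_cases hz : z ∈ A
    · have : q z ≤ lam * p z := le_of_lt hz
      simp [hz, min_eq_right this, q]
    · have : lam * p z ≤ q z := not_lt.1 hz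
      simp [hz, min_eq_left this, p]
  · have hle : (P + Q).withDensity (fun z => min (lam * p z) (q z)) ≤ lam • P ⊓ Q := by
      refine le_inf ?_ ?_
      · conv_rhs => rw [← hP, ← withDensity_smul _ hp]
        exact withDensity_mono (ae_of_all _ fun z => min_le_left _ _)
      · conv_rhs => rw [← hQ]
        exact withDensity_mono (ae_of_all _ fun z => min_le_right _ _)
    have := hle Set.univ
    rwa [withDensity_apply _ MeasurableSet.univ, Measure.restrict_univ] at this

end Alpha

/-! ### Differentiation of measures and the limit for finite `lam` -/

section Differentiation

theorem eventually_linear_of_tendsto {μ P Q : ℝ → ℝ} {p q u v : ℝ} (hμ : ∀ r, 0 < r → 0 < μ r)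
    (hsum : ∀ r, P r + Q r = μ r)
    (hP : Tendsto (fun r => P r / μ r) (𝓝[>] 0) (𝓝 p))
    (hQ : Tendsto (fun r => Q r / μ r) (𝓝[>] 0) (𝓝 q)) (h : 0 < u * p + v * q) :
    ∃ c ρ, 0 < c ∧ 0 < ρ ∧ ∀ r, 0 < r → r ≤ ρ → c * (P r + Q r) ≤ u * P r + v * Q r := by
  have hev := ((hP.const_mul u).add (hQ.const_mul v)).eventually_const_le (half_lt_self h)
  obtain ⟨ρ, hρ, hρ'⟩ := mem_nhdsGT_iff_exists_Ioc_subset.1 hev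
  refine ⟨(u * p + v * q) / 2, ρ, half_pos h, hρ, fun r h0 hr => ?_⟩
  have h1 := hρ' ⟨h0, hr⟩
  simp only [Set.mem_ofPred_eq] at h1
  have h2 := mul_le_mul_of_nonneg_right h1 (hμ r h0).le
  rw [hsum]
  refine h2.trans (le_of_eq ?_)
  have := (hμ r h0).ne'
  field_simp

variable {E : Type*} [MetricSpace E] [SecondCountableTopology E] [MeasurableSpace E]
  [BorelSpace E] (P Q : Measure E) [IsProbabilityMeasure P]
  [IsProbabilityMeasure Q]

theorem alpha_le_expectedRisk (lam γ : ℝ≥0∞) (k n : ℕ) :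
    alpha P Q lam ≤ expectedRisk P Q lam γ k n := by
  calc alpha P Q lam = ∫⁻ _ : Sample E n, alpha P Q lam ∂(sampleLaw P Q n) := by simp
    _ ≤ _ := lintegral_mono fun s => alpha_le_risk P Q (measurable_knnClassifier_right k γ s)
      (knnClassifier_le_one k γ s)

variable [HasBesicovitchCovering E]

/-- The exceptional null set is chosen before `u` and `v`. Restricting to the support of `P + Q`
makes all ball masses positive. -/
theorem ae_tendsto_prob_linear_votes : ∀ᵐ z ∂(P + Q), ∀ u v : ℝ,
    0 < u * (P.rnDeriv (P + Q) z).toReal + v * (Q.rnDeriv (P + Q) z).toReal →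
    Tendsto (fun p : ℕ × ℕ => sampleLaw P Q p.2
      {s | ¬ 0 < u * (votes p.1 s z).1 + v * (votes p.1 s z).2}) regime (𝓝 0) := by
  filter_upwards [Besicovitch.ae_tendsto_rnDeriv P (P + Q), Besicovitch.ae_tendsto_rnDeriv Q (P + Q),
    Measure.rnDeriv_lt_top P (P + Q), Measure.rnDeriv_lt_top Q (P + Q),
    (P + Q).support_mem_ae] with z hP hQ hp hq hz u v huv
  have hpos : ∀ r : ℝ, 0 < r → 0 < (P + Q).real (Metric.closedBall z r) := fun r hr =>
    ENNReal.toReal_pos ((Measure.mem_support_iff_forall z).1 hz _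
      (Metric.closedBall_mem_nhds z hr)).ne' (measure_ne_top _ _)
  have conv : ∀ (ρ : Measure E) (d : ℝ≥0∞), d < ∞ →
      Tendsto (fun r => ρ (Metric.closedBall z r) / (P + Q) (Metric.closedBall z r)) (𝓝[>] 0) (𝓝 d) →
      Tendsto (fun r => ρ.real (Metric.closedBall z r) / (P + Q).real (Metric.closedBall z r))
        (𝓝[>] 0) (𝓝 d.toReal) := by
    intro ρ d hd h
    have := (ENNReal.tendsto_toReal hd.ne).comp h
    simpa only [Function.comp_def, ENNReal.toReal_div, measureReal_def] using this
  obtain ⟨c, ρ, hc, hρ, hlin⟩ := eventually_linear_of_tendsto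
    (μ := fun r => (P + Q).real (Metric.closedBall z r))
    (P := fun r => P.real (Metric.closedBall z r)) (Q := fun r => Q.real (Metric.closedBall z r))
    hpos (fun r => (measureReal_add_apply (μ₁ := P) (μ₂ := Q)).symm) (conv P _ hp hP) (conv Q _ hq hQ) huv
  exact tendsto_prob_linear_votes P Q z hc hρ hlin (hpos _ (half_pos hρ))

theorem ae_tendsto_rejectProb {lam : ℝ≥0∞} (hlam : lam ≠ ∞) : ∀ᵐ z ∂(P + Q),
    Q.rnDeriv (P + Q) z < lam * P.rnDeriv (P + Q) z →
    Tendsto (fun p : ℕ × ℕ => rejectProb P Q lam p.1 p.2 z) regime (𝓝 0) := by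
  filter_upwards [ae_tendsto_prob_linear_votes P Q, Measure.rnDeriv_lt_top P (P + Q),
    Measure.rnDeriv_lt_top Q (P + Q)] with z hz hp hq h
  rw [← ENNReal.toReal_lt_toReal hq.ne (ENNReal.mul_ne_top hlam hp.ne), ENNReal.toReal_mul] at h
  refine tendsto_of_tendsto_of_tendsto_of_le_of_le tendsto_const_nhds
    (hz lam.toReal (-1) (by linarith)) (fun _ => zero_le) fun p => ?_
  refine rejectProb_le_of_subset P Q fun s hs => mem_acceptSet_of_lt ?_
  rw [Set.mem_ofPred_eq, not_not] at hs
  rw [natCast_lt_mul_iff hlam]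
  linarith

theorem ae_tendsto_acceptProb {lam : ℝ≥0∞} (hlam : lam ≠ ∞) : ∀ᵐ z ∂(P + Q),
    lam * P.rnDeriv (P + Q) z < Q.rnDeriv (P + Q) z →
    Tendsto (fun p : ℕ × ℕ => acceptProb P Q lam p.1 p.2 z) regime (𝓝 0) := by
  filter_upwards [ae_tendsto_prob_linear_votes P Q, Measure.rnDeriv_lt_top P (P + Q),
    Measure.rnDeriv_lt_top Q (P + Q)] with z hz hp hq h
  rw [← ENNReal.toReal_lt_toReal (ENNReal.mul_ne_top hlam hp.ne) hq.ne, ENNReal.toReal_mul] at h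
  refine tendsto_of_tendsto_of_tendsto_of_le_of_le tendsto_const_nhds
    (hz (-lam.toReal) 1 (by linarith)) (fun _ => zero_le) fun p => ?_
  refine acceptProb_le_of_subset P Q fun s hs => notMem_acceptSet_of_lt ?_
  rw [Set.mem_ofPred_eq, not_not] at hs
  rw [mul_lt_natCast_iff hlam]
  linarith

theorem tendsto_expectedRisk {lam : ℝ≥0∞} (hlam : lam ≠ ∞) :
    Tendsto (fun p : ℕ × ℕ => expectedRisk P Q lam lam p.1 p.2) regime (𝓝 (alpha P Q lam)) := by
  set p := P.rnDeriv (P + Q) with hpdef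
  set q := Q.rnDeriv (P + Q) with hqdef
  have hp : Measurable p := Measure.measurable_rnDeriv _ _
  have hq : Measurable q := Measure.measurable_rnDeriv _ _
  have hR : ∀ k n, Measurable fun z => lam * (p z * rejectProb P Q lam k n z) := fun k n =>
    (hp.mul (measurable_rejectProb P Q lam k n)).const_mul _
  have hA : ∀ k n, Measurable fun z => q z * acceptProb P Q lam k n z := fun k n =>
    hq.mul (measurable_acceptProb P Q lam k n)
  have hrisk : ∀ k n, expectedRisk P Q lam lam k n =
      ∫⁻ z, (lam * (p z * rejectProb P Q lam k n z) + q z * acceptProb P Q lam k n z) ∂(P + Q) := by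
    intro k n
    have hpR : Measurable fun z => p z * rejectProb P Q lam k n z :=
      hp.mul (measurable_rejectProb P Q lam k n)
    rw [lintegral_add_right _ (hA k n), lintegral_const_mul _ hpR,
      lintegral_rnDeriv_mul (absolutelyContinuous_add_left P Q)
        (measurable_rejectProb P Q lam k n).aemeasurable,
      lintegral_rnDeriv_mul (absolutelyContinuous_add_right P Q)
        (measurable_acceptProb P Q lam k n).aemeasurable, expectedRisk_eq]
  rw [alpha_eq_lintegral_min]
  simp only [hrisk]
  refine tendsto_lintegral_filter_of_dominated_convergence (fun z => lam * p z + q z)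
    (Eventually.of_forall fun r => (hR _ _).add (hA _ _))
    (Eventually.of_forall fun r => ae_of_all _ fun z => ?_) ?_ ?_
  · have h1 := rejectProb_le_one P Q lam r.1 r.2 z
    have h2 := acceptProb_le_one P Q lam r.1 r.2 z
    calc _ ≤ lam * (p z * 1) + q z * 1 := by gcongr
      _ = _ := by simp
  · rw [lintegral_add_right _ hq, lintegral_const_mul _ hp]
    exact ENNReal.add_ne_top.2 ⟨ENNReal.mul_ne_top hlam (Measure.lintegral_rnDeriv_lt_top _ _).ne,
      (Measure.lintegral_rnDeriv_lt_top _ _).ne⟩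
  · filter_upwards [ae_tendsto_rejectProb P Q hlam, ae_tendsto_acceptProb P Q hlam,
      Measure.rnDeriv_lt_top P (P + Q), Measure.rnDeriv_lt_top Q (P + Q)] with z h1 h2 hp hq
    have hsum := rejectProb_add_acceptProb P Q lam (z := z)
    have one_of_zero : ∀ f g : ℕ × ℕ → ℝ≥0∞, (∀ r, f r + g r = 1) → Tendsto f regime (𝓝 0) →
        Tendsto g regime (𝓝 1) := by
      intro f g hfg hf
      have hg : g = fun r => 1 - f r := by
        funext r
        rw [← hfg r, ENNReal.add_sub_cancel_left]
        exact ne_top_of_le_ne_top ENNReal.one_ne_top (hfg r ▸ le_self_add)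
      rw [hg]
      simpa using ENNReal.Tendsto.sub (tendsto_const_nhds (x := (1 : ℝ≥0∞))) hf
        (Or.inl ENNReal.one_ne_top)
    have hlim : ∀ x y : ℝ≥0∞,
        Tendsto (fun r : ℕ × ℕ => rejectProb P Q lam r.1 r.2 z) regime (𝓝 x) →
        Tendsto (fun r : ℕ × ℕ => acceptProb P Q lam r.1 r.2 z) regime (𝓝 y) →
        Tendsto (fun r : ℕ × ℕ => lam * (p z * rejectProb P Q lam r.1 r.2 z) +
          q z * acceptProb P Q lam r.1 r.2 z) regime (𝓝 (lam * (p z * x) + q z * y)) :=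
      fun x y hx hy => (ENNReal.Tendsto.const_mul (ENNReal.Tendsto.const_mul hx (Or.inr hp.ne))
        (Or.inr hlam)).add (ENNReal.Tendsto.const_mul hy (Or.inr hq.ne))
    rcases lt_trichotomy (q z) (lam * p z) with h | h | h
    · have hr := h1 h
      have ha := one_of_zero _ _ (fun r => hsum r.1 r.2) hr
      have := hlim _ _ hr ha
      rw [min_eq_right h.le]
      simpa using this
    -- At a tie the vote need not converge, but the integrand is constant because the two
    -- probabilities sum to `1`.
    · rw [min_eq_right h.le]
      refine tendsto_const_nhds.congr fun r => ?_
      rw [← mul_assoc, ← h, ← mul_add, hsum, mul_one]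
    · have ha := h2 h
      have hr := one_of_zero _ _ (fun r => (add_comm _ _).trans (hsum r.1 r.2)) ha
      have := hlim _ _ hr ha
      rw [min_eq_left h.le]
      simpa using this

theorem mem_optimalParams_of_ne_top {lam : ℝ≥0∞} (hlam : lam ≠ ∞) : lam ∈ optimalParams P Q lam :=
  ⟨alpha P Q lam, tendsto_expectedRisk P Q hlam, fun _ =>
    le_liminf_of_le (by isBoundedDefault)
      (Eventually.of_forall fun _ => alpha_le_expectedRisk P Q lam _ _ _)⟩

end Differentiation

/-! ### The case `lam = ∞` -/

/-- Since `P` charges neighbourhoods of `w`, a good `z` lies within `ρ / 8` of it. For rational `t`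
between `ρ / 4` and `ρ / 2`, the ball around `z` contains the `ρ / 8`-ball of `w`, charged by `Q`,
and is contained in the `ρ`-ball, so `P` lives there. Letting `ρ` shrink makes `P` a point mass at
`w`. -/
theorem measure_compl_ball_eq_zero_of_mem_support {E : Type*} [PseudoMetricSpace E]
    [MeasurableSpace E] {P Q : Measure E}
    (h : ∀ᵐ z ∂P, ∀ t : ℚ, Q (Metric.ball z t) = 0 ∨ P (Metric.ball z t)ᶜ = 0) {w : E}
    (hP : w ∈ P.support) (hQ : w ∈ Q.support) {ρ : ℝ} (hρ : 0 < ρ) :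
    P (Metric.ball w ρ)ᶜ = 0 := by
  rw [Measure.mem_support_iff_forall] at hP hQ
  obtain ⟨t, ht1, ht2⟩ := exists_rat_btwn (show ρ / 4 < ρ / 2 by linarith)
  have hpos := hP _ (Metric.ball_mem_nhds w (show 0 < ρ / 8 by positivity))
  obtain ⟨z, hzw, hz⟩ : ∃ z ∈ Metric.ball w (ρ / 8),
      ∀ t : ℚ, Q (Metric.ball z t) = 0 ∨ P (Metric.ball z t)ᶜ = 0 := by
    by_contra hc
    push Not at hc
    refine hpos.ne' (measure_mono_null (fun z hz => ?_) h)
    obtain ⟨t, h1, h2⟩ := hc z hz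
    exact fun hall => (hall t).elim h1 h2
  have hzw' : dist z w < ρ / 8 := hzw
  have hQz : Q (Metric.ball z t) ≠ 0 := by
    refine ((hQ _ (Metric.ball_mem_nhds w (show 0 < ρ / 8 by positivity))).trans_le
      (measure_mono (Metric.ball_subset_ball' ?_))).ne'
    rw [dist_comm]; linarith
  refine measure_mono_null (Set.compl_subset_compl.2 (Metric.ball_subset_ball' ?_))
    ((hz t).resolve_left hQz)
  linarith

section Top

variable {E : Type*} [PseudoMetricSpace E] [MeasurableSpace E] [BorelSpace E] {P Q : Measure E} [IsProbabilityMeasure P] [IsProbabilityMeasure Q]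

/-- With positive probability all `y`-points fall in the ball and all `x`-points outside it; then
only `y`-points vote, and every `γ` rejects. -/
theorem rejectProb_ne_zero {γ : ℝ≥0∞} {k n : ℕ} (hk : 1 ≤ k) (hkn : k ≤ n) {z : E} {t : ℝ}
    (hQ : Q (Metric.ball z t) ≠ 0) (hP : P (Metric.ball z t)ᶜ ≠ 0) :
    rejectProb P Q γ k n z ≠ 0 := by
  have hO : MeasurableSet (Metric.ball z t) := Metric.isOpen_ball.measurableSet
  set B : Set (Sample E n) := (Set.univ.pi fun _ => (Metric.ball z t)ᶜ) ×ˢ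
    (Set.univ.pi fun _ => Metric.ball z t) with hB
  have hBm : MeasurableSet B :=
    (MeasurableSet.univ_pi fun _ => hO.compl).prod (MeasurableSet.univ_pi fun _ => hO)
  have hBpos : sampleLaw P Q n B ≠ 0 := by
    rw [hB, sampleLaw, Measure.prod_prod, Measure.pi_pi, Measure.pi_pi]
    simp [hQ, hP]
  have hle : sampleLaw P Q n B ≤ rejectProb P Q γ k n z := by
    rw [← lintegral_indicator_one hBm]
    refine lintegral_mono fun s => ?_
    by_cases hs : s ∈ B
    · have h1 : ∀ i, s.1 i ∉ Metric.ball z t := fun i => hs.1 i trivial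
      have h2 : ∀ i, s.2 i ∈ Metric.ball z t := fun i => hs.2 i trivial
      have hsub : knnBall k (pooled s) z ⊆ Metric.ball z t :=
        knnBall_subset_ball (by rw [count_eq_of_forall h2]; omega)
      have ha : count s.1 (knnBall k (pooled s) z) = 0 :=
        (count_eq_zero_iff _ _).2 fun i hi => h1 i (hsub hi)
      have hb : 0 < count s.2 (knnBall k (pooled s) z) := by
        have := le_count_knnBall (k := k) s z (by omega)
        omega
      have : votes k s z ∉ acceptSet γ := notMem_acceptSet_of_lt (by
        simp only [votes, ha, Nat.cast_zero, mul_zero]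
        exact_mod_cast hb)
      simp [knnClassifier_eq_indicator, hs, this]
    · simp [hs]
  exact fun h => hBpos (le_antisymm (h ▸ hle) zero_le)

/-- A `y`-point strictly closer than an `x`-point would be separated from it by a rational radius, a
null event by hypothesis. So almost surely a kNN ball with a `y`-point also contains an `x`-point,
and without `y`-votes the rule accepts as `0 ≤ ∞ * a`. -/
theorem rejectProb_top_eq_zero {k n : ℕ} (hk : 1 ≤ k) (hkn : k ≤ n) {z : E}
    (h : ∀ t : ℚ, Q (Metric.ball z t) = 0 ∨ P (Metric.ball z t)ᶜ = 0) :
    rejectProb P Q ∞ k n z = 0 := by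
  set B : Set (Sample E n) := ⋃ t : ℚ, ⋃ i : Fin n, ⋃ j : Fin n,
    {s | s.1 i ∈ (Metric.ball z t)ᶜ ∧ s.2 j ∈ Metric.ball z t} with hB
  have hB0 : sampleLaw P Q n B = 0 := by
    refine measure_iUnion_null fun t => measure_iUnion_null fun i => measure_iUnion_null fun j => ?_
    have hO : MeasurableSet (Metric.ball z (t : ℝ)) := Metric.isOpen_ball.measurableSet
    rcases h t with h0 | h0
    · refine measure_mono_null (t := {s : Sample E n | s.2 ∈ {x : Fin n → E | x j ∈ Metric.ball z t}})
        (fun s hs => hs.2) ?_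
      rw [sampleLaw_snd_preimage]
      exact ((measurePreserving_eval (fun _ : Fin n => Q) j).measure_preimage
        hO.nullMeasurableSet).trans h0
    · refine measure_mono_null (t := {s : Sample E n | s.1 ∈ {x : Fin n → E | x i ∈ (Metric.ball z t)ᶜ}})
        (fun s hs => hs.1) ?_
      rw [sampleLaw_fst_preimage]
      exact ((measurePreserving_eval (fun _ : Fin n => P) i).measure_preimage
        hO.compl.nullMeasurableSet).trans h0
  refine le_antisymm ((rejectProb_le_of_subset P Q fun s hs => ?_).trans hB0.le) zero_le
  have hdist : ∀ i j, dist (s.1 i) z ≤ dist (s.2 j) z := by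
    intro i j
    by_contra hlt
    obtain ⟨t, h1, h2⟩ := exists_rat_btwn (not_le.1 hlt)
    refine hs ?_
    simp only [hB, Set.mem_iUnion]
    exact ⟨t, i, j, by simpa using h2.le, by simpa using h1⟩
  refine Or.inl ⟨le_top, ?_⟩
  by_cases hb : (votes k s z).2 = 0
  · simp [hb]
  · have ha : (votes k s z).1 ≠ 0 := by
      intro ha
      simp only [votes] at ha hb
      rw [count_eq_zero_iff] at ha hb
      push Not at hb
      obtain ⟨j, hj⟩ := hb
      have hi := ha ⟨0, by omega⟩
      rw [mem_knnBall_pooled] at hi hj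
      have hsub := Metric.ball_subset_ball (x := z) (hdist ⟨0, by omega⟩ j)
      have h1 := count_mono s.1 hsub
      have h2 := count_mono s.2 hsub
      omega
    rw [ENNReal.top_mul (by exact_mod_cast ha)]
    exact le_top

theorem tendsto_acceptProb_top {z : E} (hP : z ∉ P.support) (hQ : z ∈ Q.support) :
    Tendsto (fun p : ℕ × ℕ => acceptProb P Q ∞ p.1 p.2 z) regime (𝓝 0) := by
  obtain ⟨U, hU, hU0⟩ := Measure.notMem_support_iff_exists.1 hP
  obtain ⟨r, hr, hrU⟩ := Metric.mem_nhds_iff.1 hU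
  have hP0 : P (Metric.ball z r) = 0 := measure_mono_null hrU hU0
  set q := Q.real (Metric.ball z r) with hq
  have hO : MeasurableSet (Metric.ball z r) := Metric.isOpen_ball.measurableSet
  have hq0 : 0 < q := ENNReal.toReal_pos
    ((Measure.mem_support_iff_forall z).1 hQ _ (Metric.ball_mem_nhds z hr)).ne'
    (measure_ne_top _ _)
  refine tendsto_of_tendsto_of_tendsto_of_le_of_le' tendsto_const_nhds
    (tendsto_regime_ofReal_div 2) (Eventually.of_forall fun _ => zero_le) ?_
  filter_upwards [eventually_regime_le, eventually_regime_le_mul (half_pos hq0)]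
    with ⟨k, n⟩ ⟨hk, hkn⟩ hkq
  dsimp only at hk hkn hkq ⊢
  have hk' : (0 : ℝ) < k := by exact_mod_cast hk
  have hn' : (0 : ℝ) < n := by exact_mod_cast hk.trans hkn
  set B1 : Set (Sample E n) := ⋃ i : Fin n, {s | s.1 ∈ {x | x i ∈ Metric.ball z r}}
  set B2 : Set (Sample E n) :=
    {s | s.2 ∈ {x | n * q / 2 < |count x (Metric.ball z r) - n * Q.real (Metric.ball z r)|}}
  have e1 : sampleLaw P Q n B1 = 0 := by
    refine measure_iUnion_null fun i => ?_
    rw [sampleLaw_fst_preimage]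
    exact ((measurePreserving_eval (fun _ : Fin n => P) i).measure_preimage
      hO.nullMeasurableSet).trans hP0
  have e2 : sampleLaw P Q n B2 ≤ ENNReal.ofReal (2 / k) := by
    rw [sampleLaw_snd_preimage]
    refine (meas_count_deviation_le Q n hO (by positivity)).trans (ENNReal.ofReal_le_ofReal ?_)
    rw [← hq]
    calc n * q / (n * q / 2) ^ 2 = 2 / (q / 2 * n) := by field_simp
      _ ≤ 2 / k := by gcongr
  calc acceptProb P Q ∞ k n z ≤ sampleLaw P Q n (B1 ∪ B2) := by
        refine acceptProb_le_of_subset P Q fun s hs => ?_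
        simp only [Set.mem_union, not_or] at hs
        obtain ⟨h1, h2⟩ := hs
        have h1' : ∀ i, s.1 i ∉ Metric.ball z r := by
          simpa [B1] using h1
        have h3 := (abs_le.1 (not_lt.1 (show ¬ n * q / 2 <
          |count s.2 (Metric.ball z r) - n * Q.real (Metric.ball z r)| from h2))).1
        have h4 : (k : ℝ) ≤ count s.2 (Metric.ball z r) := by rw [← hq] at h3; linarith
        have h4' : k ≤ count s.2 (Metric.ball z r) := by exact_mod_cast h4
        have hsub : knnBall k (pooled s) z ⊆ Metric.ball z r := knnBall_subset_ball (by omega)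
        have ha : count s.1 (knnBall k (pooled s) z) = 0 :=
          (count_eq_zero_iff _ _).2 fun i hi => h1' i (hsub hi)
        have hb : 0 < count s.2 (knnBall k (pooled s) z) := by
          have := le_count_knnBall (k := k) s z (by omega)
          omega
        refine notMem_acceptSet_of_lt ?_
        simp only [votes, ha, Nat.cast_zero, mul_zero]
        exact_mod_cast hb
    _ ≤ sampleLaw P Q n B1 + sampleLaw P Q n B2 := measure_union_le _ _
    _ ≤ ENNReal.ofReal (2 / k) := by rw [e1, zero_add]; exact e2

end Top

variable {E : Type*} [MetricSpace E] [SecondCountableTopology E] [MeasurableSpace E]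
  [BorelSpace E] (P Q : Measure E) [IsProbabilityMeasure P] [IsProbabilityMeasure Q]

/-- Only a vanishing false positive rate and `Q P.support > 0` need an argument. The supports then
share a point `w`, which forces `P` to be concentrated at `w`. Since `w` is an atom of `P`, it is
accepted almost surely, which costs `Q {w}`. -/
theorem measure_support_le_expectedRisk_top
    (h : ∀ᵐ z ∂P, ∀ t : ℚ, Q (Metric.ball z t) = 0 ∨ P (Metric.ball z t)ᶜ = 0)
    (γ : ℝ≥0∞) (k n : ℕ) : Q P.support ≤ expectedRisk P Q ∞ γ k n := by
  rw [expectedRisk_eq]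
  by_cases h0 : ∫⁻ z, rejectProb P Q γ k n z ∂P = 0
  swap
  · simp [ENNReal.top_mul h0]
  rcases eq_or_ne (Q P.support) 0 with hS | hS
  · simp [hS]
  obtain ⟨w, hwP, hwQ⟩ := Measure.nonempty_inter_support_of_pos (pos_iff_ne_zero.2 hS)
  have hw : P {w}ᶜ = 0 := by
    have : ({w}ᶜ : Set E) ⊆ ⋃ m : ℕ, (Metric.ball w (1 / ((m : ℝ) + 1)))ᶜ := by
      intro x hx
      obtain ⟨m, hm⟩ := exists_nat_one_div_lt (dist_pos.2 hx)
      exact Set.mem_iUnion.2 ⟨m, by simpa using hm.le⟩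
    exact measure_mono_null this (measure_iUnion_null fun m =>
      measure_compl_ball_eq_zero_of_mem_support h hwP hwQ (by positivity))
  have hSw : P.support ⊆ {w} := Measure.support_subset_of_isClosed isClosed_singleton hw
  have hPw : P {w} ≠ 0 := by
    intro h1
    have := measure_univ_le_add_compl (μ := P) {w}
    rw [h1, hw, measure_univ] at this
    simp at this
  have hrej : rejectProb P Q γ k n w = 0 := by
    rw [lintegral_eq_zero_iff (measurable_rejectProb P Q γ k n)] at h0
    by_contra hc
    exact hPw (measure_mono_null (Set.singleton_subset_iff.2 hc) h0)
  have hacc : acceptProb P Q γ k n w = 1 := by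
    simpa [hrej] using rejectProb_add_acceptProb P Q γ k n w
  calc Q P.support ≤ Q {w} := measure_mono hSw
    _ = ∫⁻ z in {w}, acceptProb P Q γ k n z ∂Q := by
      rw [lintegral_singleton, hacc, one_mul]
    _ ≤ ∫⁻ z, acceptProb P Q γ k n z ∂Q := setLIntegral_le_lintegral _ _
    _ ≤ _ := le_add_self

theorem tendsto_lintegral_acceptProb_top :
    Tendsto (fun p : ℕ × ℕ => Q P.support + ∫⁻ z in P.supportᶜ, acceptProb P Q ∞ p.1 p.2 z ∂Q)
      regime (𝓝 (Q P.support)) := by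
  have : Tendsto (fun p : ℕ × ℕ => ∫⁻ z in P.supportᶜ, acceptProb P Q ∞ p.1 p.2 z ∂Q)
      regime (𝓝 (∫⁻ z in P.supportᶜ, 0 ∂Q)) := by
    refine tendsto_lintegral_filter_of_dominated_convergence (fun _ => 1)
      (Eventually.of_forall fun p => measurable_acceptProb P Q _ _ _)
      (Eventually.of_forall fun p => ae_of_all _ fun z => acceptProb_le_one P Q _ _ _ z)
      (by simp) ?_
    filter_upwards [ae_restrict_mem Measure.isOpen_compl_support.measurableSet,
      ae_restrict_of_ae Q.support_mem_ae] with z hz hz'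
    exact tendsto_acceptProb_top hz hz'
  simpa using this.const_add (Q P.support)

theorem top_mem_optimalParams : ∞ ∈ optimalParams P Q ∞ := by
  by_cases h : ∀ᵐ z ∂P, ∀ t : ℚ, Q (Metric.ball z t) = 0 ∨ P (Metric.ball z t)ᶜ = 0
  · refine ⟨Q P.support, ?_, fun γ => le_liminf_of_le (by isBoundedDefault)
      (Eventually.of_forall fun p => measure_support_le_expectedRisk_top P Q h γ p.1 p.2)⟩
    refine tendsto_of_tendsto_of_tendsto_of_le_of_le' tendsto_const_nhds
      (tendsto_lintegral_acceptProb_top P Q)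
      (Eventually.of_forall fun p => measure_support_le_expectedRisk_top P Q h ∞ p.1 p.2) ?_
    filter_upwards [eventually_regime_le] with p hp
    have h0 : ∫⁻ z, rejectProb P Q ∞ p.1 p.2 z ∂P = 0 := by
      rw [lintegral_eq_zero_iff (measurable_rejectProb P Q _ _ _)]
      filter_upwards [h] with z hz
      exact rejectProb_top_eq_zero hp.1 hp.2 hz
    rw [expectedRisk_eq, h0, mul_zero, zero_add,
      ← lintegral_add_compl _ Measure.isClosed_support.measurableSet]
    gcongr
    calc ∫⁻ z in P.support, acceptProb P Q ∞ p.1 p.2 z ∂Q ≤ ∫⁻ z in P.support, 1 ∂Q :=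
          lintegral_mono fun z => acceptProb_le_one P Q _ _ _ z
      _ = Q P.support := by simp
  · have key : ∀ γ, ∀ᶠ p : ℕ × ℕ in regime, expectedRisk P Q ∞ γ p.1 p.2 = ∞ := by
      intro γ
      filter_upwards [eventually_regime_le] with p hp
      rw [expectedRisk_eq, ENNReal.top_mul, top_add]
      intro h0
      rw [lintegral_eq_zero_iff (measurable_rejectProb P Q _ _ _)] at h0
      refine h ?_
      filter_upwards [h0] with z hz t
      by_contra hc
      push Not at hc
      exact rejectProb_ne_zero hp.1 hp.2 hc.1 hc.2 hz
    exact ⟨∞, tendsto_const_nhds.congr' ((key ∞).mono fun p hp => hp.symm), fun γ =>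
      le_liminf_of_le (by isBoundedDefault) ((key γ).mono fun p hp => hp.ge)⟩

/-! ### Validation error, uniformly over nested classifiers -/

theorem empFnr_indicator {E : Type*} {m : ℕ} (v : Sample E m) (A : Set E) :
    empFnr v (A.indicator fun _ => 1) = (count v.2 A : ℝ≥0∞) / m := by
  classical
  rw [count_eq_card, Finset.card_filter, empFnr]
  simp [Set.indicator_apply]

theorem empFpr_indicator {E : Type*} {m : ℕ} (v : Sample E m) (A : Set E) :
    empFpr v (A.indicator fun _ => 1) = (count v.1 Aᶜ : ℝ≥0∞) / m := by
  classical
  rw [count_eq_card, Finset.card_filter, empFpr, Nat.cast_sum]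
  congr 1
  refine Finset.sum_congr rfl fun i _ => ?_
  by_cases h : v.1 i ∈ A <;> simp [h]

theorem empRisk_indicator {E : Type*} {m : ℕ} (hm : m ≠ 0) {lam : ℝ≥0∞} (hlam : lam ≠ ∞) (v : Sample E m)
    (A : Set E) : empRisk v lam (A.indicator fun _ => 1) =
      ENNReal.ofReal ((lam.toReal * count v.1 Aᶜ + count v.2 A) / m) := by
  have hm' : (0 : ℝ) < m := by exact_mod_cast Nat.pos_of_ne_zero hm
  rw [empRisk, empFnr_indicator, empFpr_indicator, add_div, mul_div_assoc,
    ENNReal.ofReal_add (by positivity) (by positivity), ENNReal.ofReal_mul ENNReal.toReal_nonneg,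
    ENNReal.ofReal_toReal hlam, ENNReal.ofReal_div_of_pos hm', ENNReal.ofReal_div_of_pos hm']
  simp

theorem risk_indicator {E : Type*} [MeasurableSpace E] {P Q : Measure E} [IsFiniteMeasure P]
    [IsFiniteMeasure Q] {lam : ℝ≥0∞} (hlam : lam ≠ ∞) {A : Set E} (hA : MeasurableSet A) : risk P Q lam (A.indicator fun _ => 1) =
      ENNReal.ofReal (lam.toReal * P.real Aᶜ + Q.real A) := by
  have h1 : ∀ z, 1 - A.indicator (fun _ => (1 : ℝ≥0∞)) z = Aᶜ.indicator (fun _ => 1) z := by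
    intro z; by_cases h : z ∈ A <;> simp [h]
  rw [risk, fpr, fnr, ENNReal.ofReal_add (by positivity) (by positivity),
    ENNReal.ofReal_mul ENNReal.toReal_nonneg, ENNReal.ofReal_toReal hlam, ofReal_measureReal,
    ofReal_measureReal]
  simp only [h1, lintegral_indicator_const hA.compl, lintegral_indicator_const hA, one_mul]

theorem sub_one_div_le_of_floor_eq {x y : ℝ} {N : ℕ} (hN : 0 < N) (hx : 0 ≤ x)
    (h : ⌊N * x⌋₊ = ⌊N * y⌋₊) : y - 1 / N ≤ x := by
  have hN' : (0 : ℝ) < N := by exact_mod_cast hN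
  have h1 : (⌊N * x⌋₊ : ℝ) ≤ N * x := Nat.floor_le (by positivity)
  have h2 : N * y < ⌊N * y⌋₊ + 1 := Nat.lt_floor_add_one _
  rw [h] at h1
  rw [sub_le_iff_le_add, ← mul_le_mul_iff_right₀ hN', mul_add, mul_one_div_cancel hN'.ne']
  linarith

section Evaluation

variable {E : Type*} [MeasurableSpace E] {P Q : Measure E} [IsProbabilityMeasure P]
  [IsProbabilityMeasure Q] {m : ℕ}

theorem measurePreserving_fst_eval (i : Fin m) :
    MeasurePreserving (fun v : Sample E m => v.1 i) (sampleLaw P Q m) P :=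
  (measurePreserving_eval (fun _ : Fin m => P) i).comp measurePreserving_fst

theorem measurePreserving_snd_eval (i : Fin m) :
    MeasurePreserving (fun v : Sample E m => v.2 i) (sampleLaw P Q m) Q :=
  (measurePreserving_eval (fun _ : Fin m => Q) i).comp measurePreserving_snd

theorem lintegral_empRisk (hm : m ≠ 0) (lam : ℝ≥0∞) {f : E → ℝ≥0∞} (hf : Measurable f) :
    ∫⁻ v : Sample E m, empRisk v lam f ∂(sampleLaw P Q m) = risk P Q lam f := by
  have hm0 : (m : ℝ≥0∞) ≠ 0 := by exact_mod_cast hm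
  have hmt : (m : ℝ≥0∞) ≠ ∞ := ENNReal.natCast_ne_top m
  have hg : Measurable fun z => 1 - f z := measurable_const.sub hf
  have h1 : ∀ i : Fin m, Measurable fun v : Sample E m => 1 - f (v.1 i) := fun i =>
    hg.comp (measurePreserving_fst_eval (P := P) (Q := Q) i).measurable
  have h2 : ∀ i : Fin m, Measurable fun v : Sample E m => f (v.2 i) := fun i =>
    hf.comp (measurePreserving_snd_eval (P := P) (Q := Q) i).measurable
  have e1 : ∫⁻ v : Sample E m, empFpr v f ∂(sampleLaw P Q m) = fpr P f := by
    have : ∀ i : Fin m, ∫⁻ v : Sample E m, (1 - f (v.1 i)) ∂(sampleLaw P Q m) = fpr P f :=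
      fun i => (measurePreserving_fst_eval i).lintegral_comp hg
    simp only [empFpr, div_eq_mul_inv]
    rw [lintegral_mul_const _ (Finset.measurable_sum _ fun i _ => h1 i),
      lintegral_finsetSum _ fun i _ => h1 i]
    simp only [this, Finset.sum_const, Finset.card_univ, Fintype.card_fin, nsmul_eq_mul]
    rw [mul_right_comm, ENNReal.mul_inv_cancel hm0 hmt, one_mul]
  have e2 : ∫⁻ v : Sample E m, empFnr v f ∂(sampleLaw P Q m) = fnr Q f := by
    have : ∀ i : Fin m, ∫⁻ v : Sample E m, f (v.2 i) ∂(sampleLaw P Q m) = fnr Q f :=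
      fun i => (measurePreserving_snd_eval i).lintegral_comp hf
    simp only [empFnr, div_eq_mul_inv]
    rw [lintegral_mul_const _ (Finset.measurable_sum _ fun i _ => h2 i),
      lintegral_finsetSum _ fun i _ => h2 i]
    simp only [this, Finset.sum_const, Finset.card_univ, Fintype.card_fin, nsmul_eq_mul]
    rw [mul_right_comm, ENNReal.mul_inv_cancel hm0 hmt, one_mul]
  have hm1 : Measurable fun v : Sample E m => empFpr v f :=
    (Finset.measurable_sum _ fun i _ => h1 i).div_const _
  have hm2 : Measurable fun v : Sample E m => empFnr v f :=
    (Finset.measurable_sum _ fun i _ => h2 i).div_const _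
  unfold empRisk risk
  rw [lintegral_add_right _ hm2, lintegral_const_mul _ hm1, e1, e2]

/-- Bracketing: indices are grouped into `N + 1` classes by `Q.real (A i)` up to `1 / N`. Within a
class the false positive count is least at the largest set and the false negative count at the
smallest, so Chebyshev is needed only at these two. The probability bound does not depend on the
size of `T`, whose finiteness merely provides the extreme indices. -/
theorem exists_deviation_set {ι : Type*} [LinearOrder ι] [Inhabited ι] {A : ι → Set E}
    (hmono : Monotone A) (hmeas : ∀ i, MeasurableSet (A i)) (T : Finset ι) {l a η : ℝ} {N : ℕ}
    (hl : 0 ≤ l) (hη : 0 < η) (hN : 0 < N) (hm : m ≠ 0)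
    (ha : ∀ i, a ≤ l * P.real (A i)ᶜ + Q.real (A i)) :
    ∃ B : Set (Sample E m), sampleLaw P Q m B ≤ ENNReal.ofReal (2 * (N + 1) / η ^ 2 / m) ∧
      ∀ v ∉ B, ∀ i ∈ T,
        a - 1 / N - (l + 1) * η ≤ (l * count v.1 (A i)ᶜ + count v.2 (A i)) / m := by
  classical
  have hm' : (0 : ℝ) < m := by exact_mod_cast Nat.pos_of_ne_zero hm
  set cls : ι → ℕ := fun i => ⌊N * Q.real (A i)⌋₊ with hcls
  set F : ℕ → Finset ι := fun c => T.filter fun i => cls i = c with hF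
  -- The default at empty classes is harmless: the deviation bounds hold at every index, and only
  -- classes of some `i ∈ T` are used.
  set lo : ℕ → ι := fun c => if h : (F c).Nonempty then (F c).min' h else default with hlo
  set hi : ℕ → ι := fun c => if h : (F c).Nonempty then (F c).max' h else default with hhi
  set B1 : ℕ → Set (Sample E m) := fun c =>
    {v | v.1 ∈ {x | η * m < |count x (A (hi c))ᶜ - m * P.real (A (hi c))ᶜ|}} with hB1
  set B2 : ℕ → Set (Sample E m) := fun c =>
    {v | v.2 ∈ {x | η * m < |count x (A (lo c)) - m * Q.real (A (lo c))|}} with hB2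
  have hbd : ∀ x : ℝ, x ≤ 1 → m * x / (η * m) ^ 2 ≤ 1 / η ^ 2 / m := by
    intro x hx
    calc m * x / (η * m) ^ 2 ≤ m * 1 / (η * m) ^ 2 := by gcongr
      _ = 1 / η ^ 2 / m := by field_simp
  have e1 : ∀ c, sampleLaw P Q m (B1 c) ≤ ENNReal.ofReal (1 / η ^ 2 / m) := by
    intro c
    rw [hB1, sampleLaw_fst_preimage]
    exact (meas_count_deviation_le P m (hmeas _).compl (by positivity)).trans
      (ENNReal.ofReal_le_ofReal (hbd _ measureReal_le_one))
  have e2 : ∀ c, sampleLaw P Q m (B2 c) ≤ ENNReal.ofReal (1 / η ^ 2 / m) := by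
    intro c
    rw [hB2, sampleLaw_snd_preimage]
    exact (meas_count_deviation_le Q m (hmeas _) (by positivity)).trans
      (ENNReal.ofReal_le_ofReal (hbd _ measureReal_le_one))
  refine ⟨⋃ c ∈ Finset.range (N + 1), (B1 c ∪ B2 c), ?_, ?_⟩
  · calc _ ≤ ∑ c ∈ Finset.range (N + 1), sampleLaw P Q m (B1 c ∪ B2 c) :=
          measure_biUnion_finset_le _ _
      _ ≤ ∑ c ∈ Finset.range (N + 1),
          (ENNReal.ofReal (1 / η ^ 2 / m) + ENNReal.ofReal (1 / η ^ 2 / m)) :=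
          Finset.sum_le_sum fun c _ => (measure_union_le _ _).trans (add_le_add (e1 c) (e2 c))
      _ = ENNReal.ofReal (2 * (N + 1) / η ^ 2 / m) := by
        rw [Finset.sum_const, Finset.card_range, ← ENNReal.ofReal_add (by positivity)
          (by positivity), nsmul_eq_mul, ← ENNReal.ofReal_natCast,
          ← ENNReal.ofReal_mul (by positivity)]
        congr 1; push_cast; ring
  · intro v hv i hi'
    have hc : cls i ∈ Finset.range (N + 1) := by
      rw [Finset.mem_range, Nat.lt_succ_iff]
      refine Nat.floor_le_of_le ?_
      have : Q.real (A i) ≤ 1 := measureReal_le_one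
      nlinarith [(Nat.cast_nonneg N : (0 : ℝ) ≤ N)]
    have hiF : i ∈ F (cls i) := by simp [hF, hi']
    have hne : (F (cls i)).Nonempty := ⟨i, hiF⟩
    have hloe : lo (cls i) = (F (cls i)).min' hne := by simp [hlo, hne]
    have hhie : hi (cls i) = (F (cls i)).max' hne := by simp [hhi, hne]
    have hlo_le : lo (cls i) ≤ i := hloe ▸ Finset.min'_le _ _ hiF
    have hhi_le : i ≤ hi (cls i) := hhie ▸ Finset.le_max' _ _ hiF
    have hcl : cls (lo (cls i)) = cls i := by
      have := Finset.min'_mem _ hne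
      rw [← hloe, hF, Finset.mem_filter] at this
      exact this.2
    have hch : cls (hi (cls i)) = cls i := by
      have := Finset.max'_mem _ hne
      rw [← hhie, hF, Finset.mem_filter] at this
      exact this.2
    simp only [Set.mem_iUnion, Set.mem_union, not_exists, not_or] at hv
    obtain ⟨h1, h2⟩ := hv _ hc
    have d1 := (abs_le.1 (not_lt.1 (show ¬ η * m <
      |count v.1 (A (hi (cls i)))ᶜ - m * P.real (A (hi (cls i)))ᶜ| from h1))).1
    have d2 := (abs_le.1 (not_lt.1 (show ¬ η * m <
      |count v.2 (A (lo (cls i))) - m * Q.real (A (lo (cls i)))| from h2))).1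
    have c1 : (count v.1 (A (hi (cls i)))ᶜ : ℝ) ≤ count v.1 (A i)ᶜ := by
      exact_mod_cast count_mono _ (Set.compl_subset_compl.2 (hmono hhi_le))
    have c2 : (count v.2 (A (lo (cls i))) : ℝ) ≤ count v.2 (A i) := by
      exact_mod_cast count_mono _ (hmono hlo_le)
    have hq := sub_one_div_le_of_floor_eq hN measureReal_nonneg (hcl.trans hch.symm)
    -- The risk bound is applied at the largest set; replacing its `Q`-mass by that of the smallest
    -- costs `1 / N`, and the two deviations cost `(l + 1) * η`.
    have key := ha (hi (cls i))
    rw [le_div_iff₀ hm']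
    have s1 : l * (m * P.real (A (hi (cls i)))ᶜ - η * m) ≤ l * count v.1 (A i)ᶜ := by
      gcongr; linarith
    have s2 : m * (Q.real (A (hi (cls i))) - 1 / N) ≤ m * Q.real (A (lo (cls i))) := by gcongr
    have s3 := mul_le_mul_of_nonneg_right key hm'.le
    nlinarith

end Evaluation

/-! ### The estimate with data split -/

/-- Votes range over a finite grid, so only finitely many decision rules differ on it. This makes
the infimum over `γ` measurable and supplies the finite index set for the bracketing. -/
theorem exists_finset_params (n : ℕ) : ∃ T : Finset ℝ≥0∞, ∀ γ, ∃ γ' ∈ T,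
    ∀ a ≤ n, ∀ b ≤ n, (a, b) ∈ acceptSet γ' ↔ (a, b) ∈ acceptSet γ := by
  classical
  set D : Set (ℕ × ℕ) := Set.Iic n ×ˢ Set.Iic n with hD
  have hDf : D.Finite := (Set.finite_Iic n).prod (Set.finite_Iic n)
  set c : ℝ≥0∞ → Set (ℕ × ℕ) := fun γ => acceptSet γ ∩ D with hc
  have hfin : (Set.range c).Finite := by
    refine hDf.finite_subsets.subset ?_
    rintro _ ⟨γ, rfl⟩
    exact Set.inter_subset_right
  refine ⟨hfin.toFinset.image (Function.invFun c), fun γ => ⟨Function.invFun c (c γ),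
    Finset.mem_image_of_mem _ (by simp), fun a ha b hb => ?_⟩⟩
  have h : c (Function.invFun c (c γ)) = c γ := Function.invFun_eq ⟨γ, rfl⟩
  have h' := Set.ext_iff.1 h (a, b)
  simpa [hc, hD, ha, hb] using h'

section Hat

variable {E : Type*} [PseudoMetricSpace E]

theorem exists_finset_knnClassifier (n : ℕ) : ∃ T : Finset ℝ≥0∞, ∀ γ, ∃ γ' ∈ T,
    ∀ (k : ℕ) (s : Sample E n), knnClassifier k γ' s = knnClassifier k γ s := by
  obtain ⟨T, hT⟩ := exists_finset_params n
  refine ⟨T, fun γ => ?_⟩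
  obtain ⟨γ', h1, h2⟩ := hT γ
  refine ⟨γ', h1, fun k s => funext fun z => ?_⟩
  have h3 : votes k s z ∈ acceptSet γ' ↔ votes k s z ∈ acceptSet γ :=
    h2 _ (count_le _ _) _ (count_le _ _)
  rw [knnClassifier_eq_indicator, knnClassifier_eq_indicator]
  by_cases h : votes k s z ∈ acceptSet γ
  · simp [h, h3.2 h]
  · simp [h, mt h3.1 h]

/-- The set of points at which the classifier with parameter `γ` predicts `1`. -/
def acceptRegion {n : ℕ} (k : ℕ) (s : Sample E n) (γ : ℝ≥0∞) : Set E :=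
  {z | votes k s z ∈ acceptSet γ}

theorem knnClassifier_eq_indicator_acceptRegion {n : ℕ} (k : ℕ) (s : Sample E n) (γ : ℝ≥0∞) :
    knnClassifier k γ s = (acceptRegion k s γ).indicator fun _ => 1 := by
  funext z
  rw [knnClassifier_eq_indicator]
  rfl

theorem acceptRegion_mono {n : ℕ} (k : ℕ) (s : Sample E n) : Monotone (acceptRegion k s) :=
  fun _ _ h _ hz => acceptSet_mono h hz

variable [SecondCountableTopology E] [MeasurableSpace E] [BorelSpace E]

theorem measurableSet_acceptRegion {n : ℕ} (k : ℕ) (s : Sample E n) (γ : ℝ≥0∞) :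
    MeasurableSet (acceptRegion k s γ) := by
  have h := measurable_knnClassifier_right k γ s
  have : acceptRegion k s γ = {z | knnClassifier k γ s z = 1} := by
    ext z
    simp [knnClassifier_eq_indicator_acceptRegion]
  rw [this]
  exact h (measurableSet_singleton 1)

theorem measurable_empRisk_knnClassifier {n m : ℕ} (lam : ℝ≥0∞) (k : ℕ) (γ : ℝ≥0∞) :
    Measurable fun w : Sample E n × Sample E m => empRisk w.2 lam (knnClassifier k γ w.1) := by
  have h := measurable_knnClassifier (E := E) (n := n) k γ
  have h1 : ∀ i : Fin m, Measurable fun w : Sample E n × Sample E m =>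
      1 - knnClassifier k γ w.1 (w.2.1 i) := fun i =>
    measurable_const.sub (Measurable.comp (g := fun x : Sample E n × E => knnClassifier k γ x.1 x.2)
      (f := fun w : Sample E n × Sample E m => (w.1, w.2.1 i)) h (by fun_prop))
  have h2 : ∀ i : Fin m, Measurable fun w : Sample E n × Sample E m =>
      knnClassifier k γ w.1 (w.2.2 i) := fun i =>
    Measurable.comp (g := fun x : Sample E n × E => knnClassifier k γ x.1 x.2)
      (f := fun w : Sample E n × Sample E m => (w.1, w.2.2 i)) h (by fun_prop)
  exact (((Finset.measurable_sum _ fun i _ => h1 i).div_const _).const_mul _).add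
    ((Finset.measurable_sum _ fun i _ => h2 i).div_const _)

theorem measurable_alphaHat {n m : ℕ} (lam : ℝ≥0∞) (k : ℕ) :
    Measurable fun w : Sample E n × Sample E m => alphaHat lam k w.1 w.2 := by
  obtain ⟨T, hT⟩ := exists_finset_knnClassifier (E := E) n
  have hinf : ∀ w : Sample E n × Sample E m,
      (⨅ γ : ℝ≥0∞, empRisk w.2 lam (knnClassifier k γ w.1)) =
        ⨅ γ ∈ T, empRisk w.2 lam (knnClassifier k γ w.1) := by
    intro w
    refine le_antisymm (le_iInf₂ fun γ _ => iInf_le _ γ) (le_iInf fun γ => ?_)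
    obtain ⟨γ', h1, h2⟩ := hT γ
    exact (iInf₂_le γ' h1).trans (by rw [h2])
  have hconst : ∀ c : ℝ≥0∞, Measurable fun w : Sample E n × Sample E m =>
      empRisk w.2 lam fun _ => c := by
    intro c; simp only [empRisk, empFpr, empFnr]; fun_prop
  simp only [alphaHat, hinf]
  exact (Measurable.biInf _ T.countable_toSet fun γ _ =>
    measurable_empRisk_knnClassifier lam k γ).inf ((hconst 1).inf (hconst 0))

variable (P Q : Measure E) [IsProbabilityMeasure P] [IsProbabilityMeasure Q]

theorem expectedAlphaHat_eq (lam : ℝ≥0∞) (k n m : ℕ) :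
    expectedAlphaHat P Q lam k n m =
      ∫⁻ s : Sample E n, ∫⁻ v : Sample E m, alphaHat lam k s v ∂(sampleLaw P Q m)
        ∂(sampleLaw P Q n) :=
  lintegral_prod _ (measurable_alphaHat lam k).aemeasurable

theorem expectedAlphaHat_le_expectedRisk (lam γ : ℝ≥0∞) {k n m : ℕ} (hm : m ≠ 0) :
    expectedAlphaHat P Q lam k n m ≤ expectedRisk P Q lam γ k n := by
  rw [expectedAlphaHat_eq]
  refine lintegral_mono fun s => ?_
  rw [← lintegral_empRisk hm lam (measurable_knnClassifier_right k γ s)]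
  exact lintegral_mono fun v => inf_le_left.trans (iInf_le _ γ)

/-- The training sample is frozen, so the acceptance regions are a deterministic chain. Off the
deviation set the estimate is at least `alpha - δ`; on it, at most the probability of that set is
lost, as `alpha ≤ 1`. -/
theorem alpha_le_lintegral_alphaHat {lam : ℝ≥0∞} (hlam : lam ≠ ∞) {η : ℝ} {N : ℕ} (hη : 0 < η)
    (hN : 0 < N) {k n m : ℕ} (hm : m ≠ 0) (s : Sample E n) :
    alpha P Q lam ≤ ∫⁻ v : Sample E m, alphaHat lam k s v ∂(sampleLaw P Q m) +
      ENNReal.ofReal (1 / N + (lam.toReal + 1) * η + 2 * (N + 1) / η ^ 2 / m) := by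
  have hm0 : (m : ℝ≥0∞) ≠ 0 := by exact_mod_cast hm
  have hmt : (m : ℝ≥0∞) ≠ ∞ := ENNReal.natCast_ne_top m
  have hα1 : alpha P Q lam ≤ 1 := by
    simpa [risk, fpr, fnr] using alpha_le_risk P Q (lam := lam) (f := fun _ => 1)
      measurable_const fun _ => le_rfl
  have hα0 : alpha P Q lam ≤ lam := by
    simpa [risk, fpr, fnr] using alpha_le_risk P Q (lam := lam) (f := fun _ => 0)
      measurable_const fun _ => zero_le
  have hαt : alpha P Q lam ≠ ∞ := ne_top_of_le_ne_top ENNReal.one_ne_top hα1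
  set a := (alpha P Q lam).toReal with ha
  have haα : ENNReal.ofReal a = alpha P Q lam := ENNReal.ofReal_toReal hαt
  set δ := 1 / (N : ℝ) + (lam.toReal + 1) * η with hδ
  have hl : 0 ≤ lam.toReal := ENNReal.toReal_nonneg
  have hδ0 : 0 ≤ δ := by positivity
  obtain ⟨T, hT⟩ := exists_finset_knnClassifier (E := E) n
  obtain ⟨B, hB, hBT⟩ := exists_deviation_set (P := P) (Q := Q) (m := m)
    (acceptRegion_mono k s) (measurableSet_acceptRegion k s) T (l := lam.toReal) (a := a) hl hη hN hm
    (fun γ => by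
      rw [← ENNReal.ofReal_le_ofReal_iff (by positivity), haα,
        ← risk_indicator hlam (measurableSet_acceptRegion k s γ),
        ← knnClassifier_eq_indicator_acceptRegion]
      exact alpha_le_risk P Q (measurable_knnClassifier_right k γ s) (knnClassifier_le_one k γ s))
  have hhat : ∀ v ∉ B, ENNReal.ofReal (a - δ) ≤ alphaHat lam k s v := by
    intro v hv
    have hle : ENNReal.ofReal (a - δ) ≤ alpha P Q lam := by
      rw [← haα]; exact ENNReal.ofReal_le_ofReal (by linarith)
    -- The constant classifiers have no sampling error: their empirical risks are exactly `1` and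
    -- `lam`, both at least `alpha`.
    refine le_inf (le_iInf fun γ => ?_) (le_inf ?_ ?_)
    · obtain ⟨γ', h1, h2⟩ := hT γ
      rw [← h2, knnClassifier_eq_indicator_acceptRegion, empRisk_indicator hm hlam]
      refine ENNReal.ofReal_le_ofReal ?_
      have := hBT v hv γ' h1
      linarith
    · refine hle.trans (hα1.trans (le_of_eq ?_))
      simp [empRisk, empFpr, empFnr, ENNReal.div_self hm0 hmt]
    · refine hle.trans (hα0.trans (le_of_eq ?_))
      simp [empRisk, empFpr, empFnr, ENNReal.div_self hm0 hmt]
  -- The deviation set is not known to be measurable here; its measurable hull has the same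
  -- probability.
  set B' := toMeasurable (sampleLaw P Q m) B with hB'
  have hB'm : MeasurableSet B' := measurableSet_toMeasurable _ _
  have h1 : ENNReal.ofReal (a - δ) * sampleLaw P Q m B'ᶜ ≤
      ∫⁻ v : Sample E m, alphaHat lam k s v ∂(sampleLaw P Q m) := by
    rw [← lintegral_indicator_const hB'm.compl]
    refine lintegral_mono fun v => ?_
    by_cases hv : v ∈ B'
    · simp [hv]
    · simpa [hv] using hhat v fun h => hv (subset_toMeasurable _ _ h)
  have h2 : ENNReal.ofReal (a - δ) ≤ 1 := by
    rw [← haα] at hα1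
    exact (ENNReal.ofReal_le_ofReal (by linarith)).trans hα1
  calc alpha P Q lam = ENNReal.ofReal ((a - δ) + δ) := by rw [← haα]; congr 1; ring
    _ ≤ ENNReal.ofReal (a - δ) + ENNReal.ofReal δ := ENNReal.ofReal_add_le
    _ = (ENNReal.ofReal (a - δ) * sampleLaw P Q m B'ᶜ + ENNReal.ofReal (a - δ) * sampleLaw P Q m B')
        + ENNReal.ofReal δ := by
      rw [← mul_add, add_comm (sampleLaw P Q m B'ᶜ), measure_add_measure_compl hB'm, measure_univ,
        mul_one]
    _ ≤ (∫⁻ v : Sample E m, alphaHat lam k s v ∂(sampleLaw P Q m) +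
        1 * ENNReal.ofReal (2 * (N + 1) / η ^ 2 / m)) + ENNReal.ofReal δ := by
      gcongr
      rw [hB', measure_toMeasurable]
      exact hB
    _ = _ := by
      rw [one_mul, add_assoc, ← ENNReal.ofReal_add (by positivity) hδ0,
        add_comm (2 * ((N : ℝ) + 1) / η ^ 2 / m)]

theorem alpha_le_expectedAlphaHat {lam : ℝ≥0∞} (hlam : lam ≠ ∞) {η : ℝ} {N : ℕ} (hη : 0 < η)
    (hN : 0 < N) {k n m : ℕ} (hm : m ≠ 0) :
    alpha P Q lam ≤ expectedAlphaHat P Q lam k n m +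
      ENNReal.ofReal (1 / N + (lam.toReal + 1) * η + 2 * (N + 1) / η ^ 2 / m) := by
  calc alpha P Q lam = ∫⁻ _ : Sample E n, alpha P Q lam ∂(sampleLaw P Q n) := by simp
    _ ≤ ∫⁻ s : Sample E n, (∫⁻ v : Sample E m, alphaHat lam k s v ∂(sampleLaw P Q m) +
      ENNReal.ofReal (1 / N + (lam.toReal + 1) * η + 2 * (N + 1) / η ^ 2 / m))
        ∂(sampleLaw P Q n) :=
      lintegral_mono fun s => alpha_le_lintegral_alphaHat P Q hlam hη hN hm s
    _ = _ := by
      rw [lintegral_add_right _ measurable_const, ← expectedAlphaHat_eq]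
      simp

/-- `N` and `η` are fixed first, each for an error of `ε / 3`, and then `m` is taken large. The
threshold for `m` is independent of `k` and `n`, so no relation between `m` and `n` is needed. -/
theorem eventually_alpha_le_expectedAlphaHat {lam : ℝ≥0∞} (hlam : lam ≠ ∞) {ε : ℝ} (hε : 0 < ε) :
    ∀ᶠ m : ℕ in atTop, ∀ k n : ℕ,
      alpha P Q lam ≤ expectedAlphaHat P Q lam k n m + ENNReal.ofReal ε := by
  have hl : 0 ≤ lam.toReal := ENNReal.toReal_nonneg
  obtain ⟨N, hN⟩ := exists_nat_one_div_lt (show 0 < ε / 3 by positivity)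
  set η := ε / 3 / (lam.toReal + 1) with hη
  have hη0 : 0 < η := by positivity
  have hη1 : (lam.toReal + 1) * η = ε / 3 := by rw [hη]; field_simp
  have hlim := tendsto_const_div_atTop_nhds_zero_nat (2 * (((N + 1 : ℕ) : ℝ) + 1) / η ^ 2)
  filter_upwards [hlim.eventually_le_const (show 0 < ε / 3 by positivity), eventually_ne_atTop 0]
    with m hm hm0 k n
  refine (alpha_le_expectedAlphaHat P Q hlam hη0 N.succ_pos hm0).trans
    (add_le_add_right (ENNReal.ofReal_le_ofReal ?_) _)
  rw [hη1]
  push_cast at hm ⊢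
  linarith

end Hat

theorem tendsto_expectedAlphaHat {E : Type*} [MetricSpace E] [SecondCountableTopology E]
    [MeasurableSpace E] [BorelSpace E] [HasBesicovitchCovering E] (P Q : Measure E)
    [IsProbabilityMeasure P] [IsProbabilityMeasure Q] {lam : ℝ≥0∞} (hlam : lam ≠ ∞) :
    Tendsto (fun p : (ℕ × ℕ) × ℕ => expectedAlphaHat P Q lam p.1.1 p.1.2 p.2)
      (regime ×ˢ atTop) (𝓝 (alpha P Q lam)) := by
  refine tendsto_order.2 ⟨fun b hb => ?_, fun b hb => ?_⟩
  · obtain ⟨c, hbc, hc⟩ := ENNReal.lt_iff_exists_add_pos_lt.1 hb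
    filter_upwards [tendsto_snd.eventually (eventually_alpha_le_expectedAlphaHat P Q hlam
      (ε := c) (by exact_mod_cast hbc))] with p hp
    by_contra hle
    refine absurd (hp p.1.1 p.1.2) (not_le.2 (lt_of_le_of_lt ?_ hc))
    rw [ENNReal.ofReal_coe_nnreal]
    exact add_le_add_left (not_lt.1 hle) _
  · filter_upwards [tendsto_fst.eventually ((tendsto_expectedRisk P Q hlam).eventually_lt_const hb),
      tendsto_snd.eventually (eventually_ne_atTop 0)] with p h1 h2
    exact (expectedAlphaHat_le_expectedRisk P Q lam lam h2).trans_lt h1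

end KnnPR

theorem mainTheorem2 {E : Type*} [NormedAddCommGroup E] [NormedSpace ℝ E] [FiniteDimensional ℝ E]
    [MeasurableSpace E] [BorelSpace E] (P Q : Measure E) [IsProbabilityMeasure P]
    [IsProbabilityMeasure Q] (lam : ℝ≥0∞) :
    lam ∈ KnnPR.optimalParams P Q lam ∧
      (lam ≠ ∞ →
        Tendsto (fun p : (ℕ × ℕ) × ℕ => KnnPR.expectedAlphaHat P Q lam p.1.1 p.1.2 p.2)
          (KnnPR.regime ×ˢ atTop) (𝓝 (KnnPR.alpha P Q lam))) := by
  refine ⟨?_, KnnPR.tendsto_expectedAlphaHat P Q⟩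
  rcases eq_or_ne lam ∞ with rfl | hlam
  · exact KnnPR.top_mem_optimalParams P Q
  · exact KnnPR.mem_optimalParams_of_ne_top P Q hlam
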